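/- **Setting.** Let $d\in\mathbb N$, $0<\delta<d$, $V(x)=\|x\|^{\delta}$ on $\mathbb R^d$ (Euclidean norm), and let $\theta=(\theta_j)_{j\ge1}$ be non-negative numbers. A spatial partition of $n\in\mathbb N_0$ is a family $\boldsymbol\lambda=(\lambda_x)_{x\in\mathbb Z^d}$ of integer partitions (finite multisets of positive integers) all of whose parts add up to $n$; $r_{xj}$ is the number of parts of $\lambda_x$ equal to $j$, and $H_0=\sum_{j\ge1} j\,r_{0j}$ is the occupation number of the origin. For $L>0$ let $$\mathbb P_{L,n}(\boldsymbol\lambda)=\frac1{Z_{L,n}}\prod_{x\in\mathbb Z^d}\prod_{j\ge1}\frac1{r_{xj}!}\Bigl(\frac{\theta_j}{j}e^{-jV(x/L)}\Bigr)^{r_{xj}},\qquad h_m=\sum_{\lambda\vdash m}\prod_{j\ge1}\frac1{r_j(\lambda)!}\Bigl(\frac{\theta_j}{j}\Bigr)^{r_j(\lambda)},$$ where $Z_{L,n}$ is the normalization, and $h_m=0$ for $m<0$. Let $\rho(z)=\sum_{j\ge1}\theta_jz^j\int_{\mathbb R^d}e^{-jV(x)}\,dx$, let $z_{\rm c}$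 be the radius of convergence of this power series, and let $$\rho_{\rm c}=\rho(z_{\rm c}),\qquad \rho_{\rm c}^L=\frac1{L^d}\,\mathbb E\Bigl[\sum_{x\in\mathbb Z^d\setminus\{0\}}\sum_{j\ge1}jR_{xj}\Bigr],\qquad \sigma_{\rm c}^2=\sum_{j\ge1}j\theta_j\int_{\mathbb R^d}e^{-jV(x)}\,dx,$$ where the $R_{xj}$ are independent Poisson variables with parameters $\frac{\theta_j}{j}z_{\rm c}^{j}e^{-jV(x/L)}$. **Theorem.** Assume that $\rho>\rho_{\rm c}$ and $\sum_{j\ge1}j\theta_j/j^{d/\delta}<\infty$. Assume moreover that there are $C,c>0$, $0\le a<\min(\frac12,1-\frac\delta d)$ and $b>a+\max(\frac12,\frac\delta d)$ such that $$C^{-1}e^{-cn^a}\le h_n\le C\,e^{cn^a}\quad\text{for all } n\ge1,\qquad \lim_{n\to\infty}\ \max_{m\in\mathbb Z,\ |m|\le n^b}\frac{h_{n+m}}{h_n}=1 .$$ Then $0<\sigma_{\rm c}^2<\infty$, the measures $\mathbb P_{L,n}$ with $n=\rho L^d\ge1$ are well-defined probability measures, and, as $L,n\to\infty$ with $n=\rho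 L^d$, the random variable $$\frac{H_0-L^d(\rho-\rho_{\rm c}^L)}{\sigma_{\rm c}L^{d/2}}$$ under $\mathbb P_{L,n}$ converges in distribution to the standard normal law $\mathcal N(0,1)$. -/

import Mathlib

open MeasureTheory ProbabilityTheory Filter Topology
open scoped NNReal ENNReal Nat

noncomputable section

namespace SpatialPartitions

/-- Sites of the lattice `ℤ^d`. -/
abbrev Site (d : ℕ) : Type := Fin d → ℤ

/-- The point `x / L` of Euclidean space attached to the site `x`. -/
def scaledSite {d : ℕ} (L : ℝ) (x : Site d) : EuclideanSpace ℝ (Fin d) :=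
  WithLp.toLp 2 fun i => (x i : ℝ) / L

/-- The trap potential `V(x) = ‖x‖^δ` (Euclidean norm). -/
def trap (d : ℕ) (δ : ℝ) : EuclideanSpace ℝ (Fin d) → ℝ := fun x => ‖x‖ ^ δ

/-- `∏_j (w_j ^ r_j) / r_j!` for the integer partition with parts `s`, where `r_j` is the number of
parts equal to `j`; the factors with `r_j = 0` are `1` and are omitted. -/
def gibbsWeight (w : ℕ → ℝ≥0) (s : Multiset ℕ) : ℝ≥0 :=
  ∏ j ∈ s.toFinset, w j ^ s.count j / ((s.count j)! : ℝ≥0)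

/-- `h_m = ∑_{λ ⊢ m} ∏_j (1 / r_j(λ)!) (θ_j / j) ^ r_j(λ)`. -/
def h (θ : ℕ → ℝ≥0) (m : ℕ) : ℝ :=
  ∑ p : m.Partition, (gibbsWeight (fun j => θ j / j) p.parts : ℝ)

/-- `h` extended to all integers by the convention `h_m = 0` for `m < 0`. -/
def hInt (θ : ℕ → ℝ≥0) (m : ℤ) : ℝ := if 0 ≤ m then h θ m.toNat else 0

/-- `max_{m ∈ [-n^b, n^b]} h_{n+m} / h_n`, over the integers `m` (a finite set containing `0` when
`n ≥ 1`, so that the supremum is a maximum). -/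
def maxRatio (θ : ℕ → ℝ≥0) (b : ℝ) (n : ℕ) : ℝ :=
  ⨆ m : {m : ℤ // |(m : ℝ)| ≤ (n : ℝ) ^ b}, hInt θ ((n : ℤ) + m) / h θ n

/-- The single-site weights `(θ_j / j) e^{-j V(x/L)}`. -/
def siteWeight {d : ℕ} (V : EuclideanSpace ℝ (Fin d) → ℝ) (θ : ℕ → ℝ≥0) (L : ℝ)
    (x : Site d) (j : ℕ) : ℝ≥0 :=
  θ j / j * Real.toNNReal (Real.exp (-(j * V (scaledSite L x))))

/-- A spatial partition of `n`: an integer partition `lam x` (a finite multiset of positive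
integers) at every site `x ∈ ℤ^d`, such that all the parts add up to `n`. -/
@[ext]
structure SpatialPartition (d n : ℕ) where
  lam : Site d →₀ Multiset ℕ
  pos : ∀ x, ∀ j ∈ lam x, 0 < j
  total : (lam.sum fun _ s => s.sum) = n

/-- The set of spatial partitions is countable and carries the discrete σ-algebra. -/
instance (d n : ℕ) : MeasurableSpace (SpatialPartition d n) := ⊤

/-- The occupation number of the origin, `H_0 = ∑_i λ_{0 i}`. -/
def originOccupation {d n : ℕ} (l : SpatialPartition d n) : ℕ := (l.lam 0).sum

/-- `∏_x ∏_j (1 / r_{xj}!) ((θ_j / j) e^{-j V(x/L)}) ^ r_{xj}`; sites with an empty partition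
contribute the factor `1`. -/
def weight {d n : ℕ} (V : EuclideanSpace ℝ (Fin d) → ℝ) (θ : ℕ → ℝ≥0) (L : ℝ)
    (l : SpatialPartition d n) : ℝ≥0 :=
  ∏ x ∈ l.lam.support, gibbsWeight (siteWeight V θ L x) (l.lam x)

/-- The normalization `Z_{L,n}`. -/
def partitionFunction {d : ℕ} (V : EuclideanSpace ℝ (Fin d) → ℝ) (θ : ℕ → ℝ≥0) (L : ℝ)
    (n : ℕ) : ℝ≥0∞ :=
  ∑' l : SpatialPartition d n, (weight V θ L l : ℝ≥0∞)

/-- The canonical measure `P_{L,n}`, which gives mass `weight l / Z_{L,n}` to `l`. -/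
def canonicalMeasure {d : ℕ} (V : EuclideanSpace ℝ (Fin d) → ℝ) (θ : ℕ → ℝ≥0) (L : ℝ)
    (n : ℕ) : Measure (SpatialPartition d n) :=
  (partitionFunction V θ L n)⁻¹ •
    Measure.sum fun l : SpatialPartition d n => (weight V θ L l : ℝ≥0∞) • Measure.dirac l

/-- `∫_{ℝ^d} e^{-j V(x)} dx`. -/
def boltzmannIntegral {d : ℕ} (V : EuclideanSpace ℝ (Fin d) → ℝ) (j : ℕ) : ℝ≥0∞ :=
  ∫⁻ x, ENNReal.ofReal (Real.exp (-(j * V x)))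

/-- The power series `ρ(z) = ∑_{j ≥ 1} θ_j z^j ∫ e^{-j V}`. -/
def density {d : ℕ} (V : EuclideanSpace ℝ (Fin d) → ℝ) (θ : ℕ → ℝ≥0) (z : ℝ≥0∞) : ℝ≥0∞ :=
  ∑' j : ℕ+, (θ j : ℝ≥0∞) * z ^ (j : ℕ) * boltzmannIntegral V j

/-- The radius of convergence `z_c` of the power series `ρ(z)` (its coefficients are nonnegative, so
this is the supremum of the `z ≥ 0` at which it converges). -/
def critFugacity {d : ℕ} (V : EuclideanSpace ℝ (Fin d) → ℝ) (θ : ℕ → ℝ≥0) : ℝ≥0∞ :=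
  sSup {z | density V θ z ≠ ∞}

/-- The transition density `ρ_c = ρ(z_c)`. -/
def critDensity {d : ℕ} (V : EuclideanSpace ℝ (Fin d) → ℝ) (θ : ℕ → ℝ≥0) : ℝ≥0∞ :=
  density V θ (critFugacity V θ)

/-- The grand-canonical measure `P_L^z`: the law of a family `(R_{xj})` of independent Poisson
variables with parameters `(θ_j / j) z^j e^{-j V(x/L)}`. -/
def grandCanonical {d : ℕ} (V : EuclideanSpace ℝ (Fin d) → ℝ) (θ : ℕ → ℝ≥0) (L : ℝ) (z : ℝ≥0) :
    Measure (Site d × ℕ+ → ℕ) :=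
  Measure.infinitePi fun p : Site d × ℕ+ => poissonMeasure (z ^ (p.2 : ℕ) * siteWeight V θ L p.1 p.2)

/-- `M = ∑_{x ≠ 0} ∑_{j ≥ 1} j R_{xj}`, the number of particles away from the origin. -/
def offOrigin {d : ℕ} (R : Site d × ℕ+ → ℕ) : ℝ≥0∞ :=
  ∑' x : {x : Site d // x ≠ 0}, ∑' j : ℕ+, ((j : ℕ) : ℝ≥0∞) * (R (x, j) : ℝ≥0∞)

/-- `ρ_c^L = L^{-d} E_L^{z_c}(M)`. -/
def critDensityAt {d : ℕ} (V : EuclideanSpace ℝ (Fin d) → ℝ) (θ : ℕ → ℝ≥0) (L : ℝ) : ℝ :=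
  (∫⁻ R, offOrigin R ∂(grandCanonical V θ L (critFugacity V θ).toNNReal)).toReal / L ^ d

/-- `σ_c² = ∑_{j ≥ 1} j θ_j ∫ e^{-j V}`. -/
def critVariance {d : ℕ} (V : EuclideanSpace ℝ (Fin d) → ℝ) (θ : ℕ → ℝ≥0) : ℝ≥0∞ :=
  ∑' j : ℕ+, ((j : ℕ) : ℝ≥0∞) * (θ j : ℝ≥0∞) * boltzmannIntegral V j

/-- `σ_c`. -/
def critStdDev {d : ℕ} (V : EuclideanSpace ℝ (Fin d) → ℝ) (θ : ℕ → ℝ≥0) : ℝ :=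
  Real.sqrt (critVariance V θ).toReal

end SpatialPartitions

end

/-! The weights are multiplicative over sites, so a spatial partition of `n` splits into an integer
partition at the origin and a configuration elsewhere. Because V(0) = 0, the origin contributes
exactly h_k, whatever L is. Hence H_0 = n - M, where P(M = m) is proportional to h_{n-m} p_L(m) and
p_L is the law of the compound Poisson sum ∑ j R_{xj} over x ≠ 0 at fugacity 1 (`tsum_weight_mul`,
`integral_originOccupation_eq_tilted`). Fugacity 1 is the critical one: the summability hypothesis
makes ρ(1) finite, and the subexponential lower bound on h_n excludes convergence beyond 1
(`critFugacity_eq_one`). So L^d ρ_c^L is the mean μ of p_L, and the claim is a central limit theorem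
for -(M - μ) under p_L tilted by h_{n-m}.

Without the tilt, the logarithm of the characteristic function of (M - μ) / L^{d/2} is a lattice
sum, that is, a Riemann sum over cells of side 1/L. Dominated convergence gives the limit -σ_c² x² /
2 (`tendsto_tsum_offWeight_cexp`).

The tilt is harmless. With N = n - ⌊μ⌋, which is of order n because ρ > ρ_c, it suffices that the
p_L-mean of |h_{n-M} / h_N - 1| tends to 0 (`tendsto_tilted`, `tendsto_tsum_abs_hInt_div_sub_one`).
For |M - μ| ≤ N^b / 4 the ratio is uniformly close to 1 by the flatness of h. Elsewhere it is at
most a constant times exp(2c n^a), whereas a Chernoff bound gives probability at most a constant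
times exp(-A n^{b-κ}), κ = max(1/2, δ/d), and b - κ > a. In κ, the 1/2 is the Gaussian scale, and
δ/d reflects the energy gap L^{-δ} of the sites x ≠ 0, which limits the exponential moments at
criticality (`tsum_tail_offOrigin_le`). -/

namespace SpatialPartitions

/-! ### The exponential formula for occupation numbers. -/

/-- The weight `∏_i a_i ^ r_i / r_i!` of the occupation numbers `r`. -/
noncomputable def occWeight {I 𝕜 : Type*} [Semifield 𝕜] (a : I → 𝕜) (r : I →₀ ℕ) : 𝕜 :=
  r.prod fun i k => a i ^ k / (k ! : 𝕜)

/-- The total size `∑_i s_i r_i`. -/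
def occSize {I : Type*} (s : I → ℕ) (r : I →₀ ℕ) : ℕ := r.sum fun i k => k * s i

/-- Distributivity: expanding the product of truncated exponential series amounts to choosing one
exponent for each index in `S`. -/
theorem sum_occWeight_box {I 𝕜 : Type*} [Field 𝕜] (a : I → 𝕜) (S : Finset I) (N : ℕ) :
    ∑ r ∈ S.finsupp (fun _ => Finset.range N), occWeight a r =
      ∏ i ∈ S, ∑ k ∈ Finset.range N, a i ^ k / (k ! : 𝕜) := by
  classical
  rw [Finset.finsupp, Finset.sum_map, Finset.prod_sum]
  refine Finset.sum_congr rfl fun p _ => ?_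
  simp only [Function.Embedding.coeFn_mk, occWeight]
  rw [Finsupp.prod_of_support_subset _ (Finsupp.support_indicator_subset S p) _ (by simp),
    ← Finset.prod_attach]
  refine Finset.prod_congr rfl fun x _ => ?_
  rw [Finsupp.indicator_of_mem x.2]

/-- Boxes are cofinal among finite sets of occupation numbers, so sums over all of them can be
computed along boxes, where they factorize. -/
theorem finset_subset_box {I : Type*} (F : Finset (I →₀ ℕ)) :
    ∃ S : Finset I, ∃ N : ℕ, ∀ S' ⊇ S, ∀ N' ≥ N, F ⊆ S'.finsupp (fun _ => Finset.range N') := by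
  classical
  refine ⟨F.biUnion fun r => r.support,
    (F.sup fun r => (r.support.sup fun i => r i)) + 1, fun S' hS N' hN r hr => ?_⟩
  rw [Finset.mem_finsupp_iff]
  refine ⟨(Finset.subset_biUnion_of_mem (fun r : I →₀ ℕ => r.support) hr).trans hS,
    fun i _ => Finset.mem_range.2 ?_⟩
  by_cases hi : i ∈ r.support
  · have h1 : r i ≤ r.support.sup fun i => r i := Finset.le_sup (f := fun i => r i) hi
    have h2 : (r.support.sup fun i => r i) ≤ F.sup fun r => (r.support.sup fun i => r i) :=
      Finset.le_sup (f := fun r : I →₀ ℕ => r.support.sup fun i => r i) hr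
    omega
  · rw [Finsupp.notMem_support_iff.1 hi]
    omega

theorem tendsto_box {I : Type*} :
    Tendsto (fun p : Finset I × ℕ => p.1.finsupp (fun _ => Finset.range p.2)) (atTop ×ˢ atTop)
      atTop := by
  rw [tendsto_atTop]
  intro F
  obtain ⟨S, N, h⟩ := finset_subset_box F
  filter_upwards [(eventually_ge_atTop S).prod_mk (eventually_ge_atTop N)] with p hp
  exact h p.1 hp.1 p.2 hp.2

theorem norm_occWeight {I : Type*} (a : I → ℂ) (r : I →₀ ℕ) :
    ‖occWeight a r‖ = occWeight (fun i => ‖a i‖) r := by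
  simp [occWeight, Finsupp.prod, norm_prod]

theorem summable_occWeight_real {I : Type*} {a : I → ℝ} (h0 : ∀ i, 0 ≤ a i) (ha : Summable a) :
    Summable (occWeight a) := by
  have hnn : ∀ r, 0 ≤ occWeight a r := fun r =>
    Finset.prod_nonneg fun i _ => div_nonneg (pow_nonneg (h0 i) _) (Nat.cast_nonneg _)
  refine summable_of_sum_le hnn (c := Real.exp (∑' i, a i)) fun F => ?_
  obtain ⟨S, N, h⟩ := finset_subset_box F
  calc ∑ r ∈ F, occWeight a r
      ≤ ∑ r ∈ S.finsupp (fun _ => Finset.range N), occWeight a r :=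
        Finset.sum_le_sum_of_subset_of_nonneg (h S le_rfl N le_rfl) fun r _ _ => hnn r
    _ = ∏ i ∈ S, ∑ k ∈ Finset.range N, a i ^ k / (k ! : ℝ) := sum_occWeight_box a S N
    _ ≤ ∏ i ∈ S, Real.exp (a i) := Finset.prod_le_prod
        (fun i _ => Finset.sum_nonneg fun k _ => div_nonneg (pow_nonneg (h0 i) _) (Nat.cast_nonneg _))
        (fun i _ => Real.sum_le_exp_of_nonneg (h0 i) N)
    _ = Real.exp (∑ i ∈ S, a i) := (Real.exp_sum _ _).symm
    _ ≤ Real.exp (∑' i, a i) := Real.exp_le_exp.2 (ha.sum_le_tsum S fun i _ => h0 i)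

theorem hasSum_occWeight {I : Type*} {a : I → ℂ} (ha : Summable fun i => ‖a i‖) :
    HasSum (occWeight a) (Complex.exp (∑' i, a i)) := by
  have hs : Summable (occWeight a) := by
    refine Summable.of_norm ?_
    simp_rw [norm_occWeight]
    exact summable_occWeight_real (fun i => norm_nonneg _) ha
  have h1 : Tendsto (fun p : Finset I × ℕ => ∏ i ∈ p.1, ∑ k ∈ Finset.range p.2, a i ^ k / (k ! : ℂ))
      (atTop ×ˢ atTop) (𝓝 (∑' r, occWeight a r)) := by
    simp_rw [← sum_occWeight_box]
    exact (show Tendsto (fun F : Finset (I →₀ ℕ) => ∑ r ∈ F, occWeight a r) atTop _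
      from hs.hasSum).comp tendsto_box
  have h2 : ∀ S : Finset I, Tendsto (fun N : ℕ => ∏ i ∈ S, ∑ k ∈ Finset.range N, a i ^ k / (k ! : ℂ))
      atTop (𝓝 (∏ i ∈ S, Complex.exp (a i))) := fun S =>
    tendsto_finsetProd _ fun i _ => by
      have := (NormedSpace.expSeries_div_hasSum_exp (a i)).tendsto_sum_nat
      rwa [← Complex.exp_eq_exp_ℂ] at this
  have h3 : Tendsto (fun S : Finset I => ∏ i ∈ S, Complex.exp (a i)) atTop
      (𝓝 (∑' r, occWeight a r)) := by
    -- The joint limit in `(S, N)` is turned into an iterated one: for large `S` the products lie in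
    -- a closed neighbourhood for all large `N`, hence so does their limit as `N → ∞`.
    rw [(closed_nhds_basis _).tendsto_right_iff]
    rintro U ⟨hU, hUc⟩
    have := (h1.eventually hU).curry
    filter_upwards [this] with S hS
    exact hUc.mem_of_tendsto (h2 S) hS
  have h4 : Tendsto (fun S : Finset I => ∏ i ∈ S, Complex.exp (a i)) atTop
      (𝓝 (Complex.exp (∑' i, a i))) := by
    simp_rw [← Complex.exp_sum]
    exact (Complex.continuous_exp.tendsto _).comp ha.of_norm.hasSum
  rw [← tendsto_nhds_unique h3 h4]
  exact hs.hasSum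

theorem occWeight_mul_exp {I : Type*} (w : I → ℂ) (s : I → ℕ) (z : ℂ) (r : I →₀ ℕ) :
    occWeight (fun i => w i * Complex.exp (z * s i)) r =
      occWeight w r * Complex.exp (z * occSize s r) := by
  simp only [occWeight, occSize, Finsupp.sum, Finsupp.prod]
  push_cast
  rw [Finset.mul_sum, Complex.exp_sum, ← Finset.prod_mul_distrib]
  refine Finset.prod_congr rfl fun i _ => ?_
  rw [mul_pow, ← Complex.exp_nat_mul]
  ring_nf

/-- The total weight of the occupation numbers of size `m`. -/
noncomputable def occCoeff {I : Type*} (w : I → ℝ) (s : I → ℕ) (m : ℕ) : ℝ :=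
  ∑' r : {r : I →₀ ℕ // occSize s r = m}, occWeight w r

theorem occWeight_nonneg {I : Type*} {w : I → ℝ} (h0 : ∀ i, 0 ≤ w i) (r : I →₀ ℕ) :
    0 ≤ occWeight w r :=
  Finset.prod_nonneg fun i _ => div_nonneg (pow_nonneg (h0 i) _) (Nat.cast_nonneg _)

theorem occCoeff_nonneg {I : Type*} {w : I → ℝ} (h0 : ∀ i, 0 ≤ w i) (s : I → ℕ) (m : ℕ) :
    0 ≤ occCoeff w s m := tsum_nonneg fun r => occWeight_nonneg h0 r

theorem ofReal_occWeight {I : Type*} (w : I → ℝ) (r : I →₀ ℕ) :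
    ((occWeight w r : ℝ) : ℂ) = occWeight (fun i => (w i : ℂ)) r := by
  simp [occWeight, Finsupp.prod]

/-- The exponential formula with parameters `w i * exp (z * s i)`, grouped by total size. It is used
off the origin for the law of M, and at the origin for the generating function of h. -/
theorem hasSum_occCoeff {I : Type*} {w : I → ℝ} (s : I → ℕ) (z : ℂ)
    (hw : Summable fun i => ‖(w i : ℂ) * Complex.exp (z * s i)‖) :
    HasSum (fun m : ℕ => (occCoeff w s m : ℂ) * Complex.exp (z * m))
      (Complex.exp (∑' i, (w i : ℂ) * Complex.exp (z * s i))) := by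
  have h := hasSum_occWeight hw
  rw [← (Equiv.sigmaFiberEquiv (occSize s)).hasSum_iff] at h
  convert h.sigma fun m => (h.summable.sigma_factor m).hasSum using 1
  funext m
  rw [occCoeff, Complex.ofReal_tsum, ← tsum_mul_right]
  refine tsum_congr fun r => ?_
  simp only [Function.comp, Equiv.sigmaFiberEquiv_apply, occWeight_mul_exp, ofReal_occWeight, r.2]

end SpatialPartitions

/-! ### Multiplicities as coordinates, and factorization at the origin. -/

namespace SpatialPartitions

/-- The multiset of positive integers in which `j` has multiplicity `s j`. -/
noncomputable def multisetOfMult (s : ℕ+ →₀ ℕ) : Multiset ℕ :=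
  (Finsupp.toMultiset s).map (↑)

@[simp] theorem multisetOfMult_zero : multisetOfMult 0 = 0 := by simp [multisetOfMult]

theorem count_multisetOfMult (s : ℕ+ →₀ ℕ) (j : ℕ+) :
    (multisetOfMult s).count (j : ℕ) = s j := by
  classical
  rw [multisetOfMult, Multiset.count_map_eq_count' _ _ PNat.coe_injective,
    Finsupp.count_toMultiset]

theorem pos_of_mem_multisetOfMult {s : ℕ+ →₀ ℕ} {j : ℕ} (hj : j ∈ multisetOfMult s) : 0 < j := by
  obtain ⟨i, -, rfl⟩ := Multiset.mem_map.1 hj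
  exact i.2

theorem multisetOfMult_injective : Function.Injective multisetOfMult := fun s t h => by
  ext j
  rw [← count_multisetOfMult, h, count_multisetOfMult]

/-- The multiplicities of the positive elements of a multiset. -/
noncomputable def multOfMultiset (t : Multiset ℕ) : ℕ+ →₀ ℕ :=
  (Multiset.toFinsupp t).comapDomain (↑) PNat.coe_injective.injOn

theorem multOfMultiset_zero : multOfMultiset 0 = 0 := by
  ext j; simp [multOfMultiset]

theorem multisetOfMult_multOfMultiset {t : Multiset ℕ} (ht : ∀ j ∈ t, 0 < j) :
    multisetOfMult (multOfMultiset t) = t := by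
  ext j
  rcases Nat.eq_zero_or_pos j with rfl | hj
  · rw [Multiset.count_eq_zero_of_notMem fun h => (pos_of_mem_multisetOfMult h).ne rfl,
      Multiset.count_eq_zero_of_notMem fun h => (ht 0 h).ne rfl]
  · have := count_multisetOfMult (multOfMultiset t) ⟨j, hj⟩
    exact this

theorem sum_multisetOfMult (s : ℕ+ →₀ ℕ) :
    (multisetOfMult s).sum = occSize (fun j : ℕ+ => (j : ℕ)) s := by
  rw [multisetOfMult, occSize]
  induction s using Finsupp.induction_linear with
  | zero => simp
  | add f g hf hg =>
    rw [map_add, Multiset.map_add, Multiset.sum_add, hf, hg,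
      Finsupp.sum_add_index' (by simp) (by simp [add_mul])]
  | single j k => simp [Multiset.map_nsmul, Multiset.sum_nsmul]

theorem gibbsWeight_multisetOfMult (w : ℕ → ℝ≥0) (s : ℕ+ →₀ ℕ) :
    gibbsWeight w (multisetOfMult s) = occWeight (fun j : ℕ+ => w j) s := by
  classical
  rw [gibbsWeight, occWeight, Finsupp.prod]
  have : (multisetOfMult s).toFinset = s.support.map ⟨_, PNat.coe_injective⟩ := by
    ext j
    simp [multisetOfMult]
  rw [this, Finset.prod_map]
  simp only [Function.Embedding.coeFn_mk, count_multisetOfMult]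

theorem bijective_partition (k : ℕ) : Function.Bijective
    (fun p : {p : ℕ+ →₀ ℕ // occSize (fun j : ℕ+ => (j : ℕ)) p = k} =>
      ({ parts := multisetOfMult p.1
         parts_pos := pos_of_mem_multisetOfMult
         parts_sum := (sum_multisetOfMult _).trans p.2 } : k.Partition)) := by
  constructor
  · intro p q hpq
    exact Subtype.ext (multisetOfMult_injective (congrArg Nat.Partition.parts hpq))
  · intro l
    have := multisetOfMult_multOfMultiset (t := l.parts) fun j hj => l.parts_pos hj
    refine ⟨⟨multOfMultiset l.parts, ?_⟩, Nat.Partition.ext this⟩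
    rw [← sum_multisetOfMult, this, l.parts_sum]

theorem h_nonneg (θ : ℕ → ℝ≥0) (k : ℕ) : 0 ≤ h θ k := Finset.sum_nonneg fun _ _ => NNReal.coe_nonneg _

theorem h_eq_tsum (θ : ℕ → ℝ≥0) (k : ℕ) :
    ENNReal.ofReal (h θ k) = ∑' p : {p : ℕ+ →₀ ℕ // occSize (fun j : ℕ+ => (j : ℕ)) p = k},
      ((occWeight (fun j : ℕ+ => θ j / (j : ℝ≥0)) p.1 : ℝ≥0) : ℝ≥0∞) := by
  rw [h, ← NNReal.coe_sum, ENNReal.ofReal_coe_nnreal, ENNReal.ofNNReal_finsetSum, ← tsum_fintype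
    (L := .unconditional _), ← (Equiv.ofBijective _ (bijective_partition k)).tsum_eq]
  refine tsum_congr fun p => ?_
  rw [Equiv.ofBijective_apply, gibbsWeight_multisetOfMult]

/-- The spatial partition with `r (x, j)` parts equal to `j` at the site `x`. -/
noncomputable def ofMult {d n : ℕ} (r : Site d × ℕ+ →₀ ℕ)
    (hr : occSize (fun i : Site d × ℕ+ => (i.2 : ℕ)) r = n) : SpatialPartition d n where
  lam := r.curry.mapRange multisetOfMult multisetOfMult_zero
  pos x j hj := pos_of_mem_multisetOfMult hj
  total := by
    rw [Finsupp.sum_mapRange_index (by simp), ← hr, occSize]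
    simp_rw [sum_multisetOfMult, occSize]
    exact Finsupp.sum_curry_index r fun _ j k => k * (j : ℕ)

theorem bijective_ofMult (d n : ℕ) : Function.Bijective
    (fun r : {r : Site d × ℕ+ →₀ ℕ // occSize (fun i : Site d × ℕ+ => (i.2 : ℕ)) r = n} =>
      ofMult r.1 r.2) := by
  constructor
  · intro r s hrs
    have h1 : r.1.curry = s.1.curry :=
      Finsupp.mapRange_injective _ multisetOfMult_zero multisetOfMult_injective
        (congrArg SpatialPartition.lam hrs)
    exact Subtype.ext (Finsupp.curryEquiv.injective h1)
  · intro l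
    have key : (l.lam.mapRange multOfMultiset multOfMultiset_zero).uncurry.curry.mapRange
        multisetOfMult multisetOfMult_zero = l.lam := by
      rw [Finsupp.curry_uncurry]
      ext1 x
      simpa using multisetOfMult_multOfMultiset (l.pos x)
    have hs : occSize (fun i : Site d × ℕ+ => (i.2 : ℕ))
        (l.lam.mapRange multOfMultiset multOfMultiset_zero).uncurry = n := by
      have := (ofMult (l.lam.mapRange multOfMultiset multOfMultiset_zero).uncurry rfl).total
      rw [← this]
      simp only [ofMult, key, l.total]
    exact ⟨⟨_, hs⟩, SpatialPartition.ext key⟩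

theorem weight_ofMult {d n : ℕ} (V : EuclideanSpace ℝ (Fin d) → ℝ) (θ : ℕ → ℝ≥0) (L : ℝ)
    (r : Site d × ℕ+ →₀ ℕ) (hr : occSize (fun i : Site d × ℕ+ => (i.2 : ℕ)) r = n) :
    weight V θ L (ofMult r hr) =
      occWeight (fun i : Site d × ℕ+ => siteWeight V θ L i.1 i.2) r := by
  change (r.curry.mapRange multisetOfMult multisetOfMult_zero).prod
    (fun x s => gibbsWeight (siteWeight V θ L x) s) = _
  rw [Finsupp.prod_mapRange_index (by simp [gibbsWeight])]
  simp_rw [gibbsWeight_multisetOfMult, occWeight]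
  -- Sums in `Additive ℝ≥0` are products in `ℝ≥0`.
  exact Finsupp.sum_curry_index (N := Additive ℝ≥0) r
    fun x j k => Additive.ofMul (siteWeight V θ L x j ^ k / (k ! : ℝ≥0))

theorem originOccupation_ofMult {d n : ℕ} (r : Site d × ℕ+ →₀ ℕ)
    (hr : occSize (fun i : Site d × ℕ+ => (i.2 : ℕ)) r = n) :
    originOccupation (ofMult r hr) = occSize (fun j : ℕ+ => (j : ℕ)) (r.curry 0) := by
  rw [← sum_multisetOfMult]
  simp [originOccupation, ofMult]

instance (d n : ℕ) : Countable (SpatialPartition d n) :=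
  (bijective_ofMult d n).surjective.countable

/-- The pairs of a site away from the origin and a part. -/
abbrev OffIndex (d : ℕ) : Type := {x : Site d // x ≠ 0} × ℕ+

theorem bijective_splitIndex (d : ℕ) : Function.Bijective
    (Sum.elim (fun j => (0, j)) (fun i => (i.1.1, i.2)) : ℕ+ ⊕ OffIndex d → Site d × ℕ+) := by
  constructor
  · rintro (j | ⟨⟨x, hx⟩, j⟩) (k | ⟨⟨y, hy⟩, k⟩) h
    · simpa using h
    · exact absurd (congrArg Prod.fst h).symm hy
    · exact absurd (congrArg Prod.fst h) hx
    · simpa using h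
  · rintro ⟨x, j⟩
    by_cases hx : x = 0
    · exact ⟨.inl j, by simp [hx]⟩
    · exact ⟨.inr (⟨x, hx⟩, j), rfl⟩

/-- Splitting the pairs of a site and a part according to whether the site is the origin. -/
noncomputable def splitIndex (d : ℕ) : ℕ+ ⊕ OffIndex d ≃ Site d × ℕ+ :=
  Equiv.ofBijective _ (bijective_splitIndex d)

/-- Multiplicities at the origin and away from it, glued together. -/
noncomputable def glueMult (d : ℕ) : (ℕ+ →₀ ℕ) × (OffIndex d →₀ ℕ) ≃ (Site d × ℕ+ →₀ ℕ) :=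
  Finsupp.sumFinsuppEquivProdFinsupp.symm.trans (Finsupp.equivCongrLeft (splitIndex d))

theorem prod_glueMult {d : ℕ} {N : Type*} [CommMonoid N] (p : ℕ+ →₀ ℕ) (r : OffIndex d →₀ ℕ)
    (g : Site d × ℕ+ → ℕ → N) :
    (glueMult d (p, r)).prod g =
      (p.prod fun j k => g (0, j) k) * r.prod fun i k => g (i.1.1, i.2) k := by
  rw [glueMult, Equiv.trans_apply, Finsupp.equivCongrLeft_apply, Finsupp.prod_equivMapDomain]
  exact Finsupp.prod_sumElim p r _

theorem occWeight_glueMult {d : ℕ} {𝕜 : Type*} [Semifield 𝕜] (a : Site d × ℕ+ → 𝕜) (p : ℕ+ →₀ ℕ)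
    (r : OffIndex d →₀ ℕ) :
    occWeight a (glueMult d (p, r)) =
      occWeight (fun j => a (0, j)) p * occWeight (fun i : OffIndex d => a (i.1.1, i.2)) r :=
  prod_glueMult p r _

theorem occSize_glueMult {d : ℕ} (s : Site d × ℕ+ → ℕ) (p : ℕ+ →₀ ℕ) (r : OffIndex d →₀ ℕ) :
    occSize s (glueMult d (p, r)) =
      occSize (fun j => s (0, j)) p + occSize (fun i : OffIndex d => s (i.1.1, i.2)) r :=
  prod_glueMult (N := Multiplicative ℕ) p r fun i k => Multiplicative.ofAdd (k * s i)

theorem curry_glueMult_zero {d : ℕ} (p : ℕ+ →₀ ℕ) (r : OffIndex d →₀ ℕ) :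
    (glueMult d (p, r)).curry 0 = p := by
  ext j
  have : (splitIndex d).symm (0, j) = .inl j := by
    rw [Equiv.symm_apply_eq]; rfl
  simp [glueMult, this]

/-- The pairs are fibred over the size `k` of their first component; the test function `F` depends
on nothing else. Values in `ℝ≥0∞` make every rearrangement free. -/
theorem tsum_convolution {A B : Type*} (sA : A → ℕ) (sB : B → ℕ) (u : A → ℝ≥0∞) (v : B → ℝ≥0∞)
    (F : ℕ → ℝ≥0∞) (n : ℕ) :
    ∑' t : {t : A × B // sA t.1 + sB t.2 = n}, u t.1.1 * v t.1.2 * F (sA t.1.1) =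
      ∑ k ∈ Finset.range (n + 1), (∑' a : {a // sA a = k}, u a.1) *
        (∑' b : {b // sB b = n - k}, v b.1) * F k := by
  have h1 : ∑' t : {t : A × B // sA t.1 + sB t.2 = n}, u t.1.1 * v t.1.2 * F (sA t.1.1) =
      ∑' a, ∑' b, {t : A × B | sA t.1 + sB t.2 = n}.indicator
        (fun t => u t.1 * v t.2 * F (sA t.1)) (a, b) := by
    rw [← ENNReal.tsum_prod]
    exact tsum_subtype {t : A × B | sA t.1 + sB t.2 = n} fun t => u t.1 * v t.2 * F (sA t.1)
  have h2 : ∀ a, ∑' b, {t : A × B | sA t.1 + sB t.2 = n}.indicator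
        (fun t => u t.1 * v t.2 * F (sA t.1)) (a, b) =
      u a * if sA a ≤ n then (∑' b : {b // sB b = n - sA a}, v b.1) * F (sA a) else 0 := by
    intro a
    split_ifs with ha
    · rw [show (∑' b : {b // sB b = n - sA a}, v b.1) =
        ∑' b, {b | sB b = n - sA a}.indicator v b from tsum_subtype {b | sB b = n - sA a} v,
        ← ENNReal.tsum_mul_right, ← ENNReal.tsum_mul_left]
      refine tsum_congr fun b => ?_
      simp only [Set.indicator, Set.mem_ofPred_eq]
      by_cases hb : sB b = n - sA a
      · rw [if_pos hb, if_pos (by omega), mul_assoc]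
      · rw [if_neg hb, if_neg (by omega)]; simp
    · rw [mul_zero, ENNReal.tsum_eq_zero]
      intro b
      exact Set.indicator_of_notMem (by simp only [Set.mem_ofPred_eq]; omega) _
  rw [h1, tsum_congr h2, ← (Equiv.sigmaFiberEquiv sA).tsum_eq, ENNReal.tsum_sigma',
    tsum_eq_sum (s := Finset.range (n + 1))]
  · refine Finset.sum_congr rfl fun k hk => ?_
    have hk' : k ≤ n := by simpa [Nat.lt_succ_iff] using hk
    rw [mul_assoc, ← ENNReal.tsum_mul_right]
    refine tsum_congr fun a => ?_
    obtain ⟨a, rfl⟩ := a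
    change u a * (if sA a ≤ n then _ else _) = _
    rw [if_pos hk']
    rfl
  · intro k hk
    have hk' : ¬ k ≤ n := by simpa [Nat.lt_succ_iff] using hk
    rw [ENNReal.tsum_eq_zero]
    intro a
    simp only [Equiv.sigmaFiberEquiv_apply, a.2, if_neg hk', mul_zero]

/-- The potential vanishes at the origin (`0 ^ δ = 0` as `δ ≠ 0`), so the weights there are those
that define `h`, for every `L`. -/
theorem siteWeight_trap_zero {d : ℕ} {δ : ℝ} (hδ : 0 < δ) (θ : ℕ → ℝ≥0) (L : ℝ) (j : ℕ) :
    siteWeight (trap d δ) θ L 0 j = θ j / j := by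
  have : scaledSite (d := d) L 0 = 0 := by ext i; simp [scaledSite]
  simp [siteWeight, trap, this, Real.zero_rpow hδ.ne']

/-- The weights of the parts away from the origin. -/
noncomputable def offWeight {d : ℕ} (V : EuclideanSpace ℝ (Fin d) → ℝ) (θ : ℕ → ℝ≥0) (L : ℝ)
    (i : OffIndex d) : ℝ := siteWeight V θ L i.1 i.2

/-- The sizes of the parts away from the origin. -/
def offSize {d : ℕ} (i : OffIndex d) : ℕ := i.2

theorem offWeight_nonneg {d : ℕ} (V : EuclideanSpace ℝ (Fin d) → ℝ) (θ : ℕ → ℝ≥0) (L : ℝ)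
    (i : OffIndex d) : 0 ≤ offWeight V θ L i := NNReal.coe_nonneg _

theorem coe_occWeight {I : Type*} (w : I → ℝ≥0) (r : I →₀ ℕ) :
    ((occWeight w r : ℝ≥0) : ℝ) = occWeight (fun i => (w i : ℝ)) r := by
  simp only [occWeight, Finsupp.prod, NNReal.coe_prod, NNReal.coe_div, NNReal.coe_pow,
    NNReal.coe_natCast]

theorem ofReal_occWeight_nnreal {I : Type*} (w : I → ℝ≥0) (r : I →₀ ℕ) :
    ENNReal.ofReal (occWeight (fun i => (w i : ℝ)) r) = ((occWeight w r : ℝ≥0) : ℝ≥0∞) := by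
  rw [← coe_occWeight, ENNReal.ofReal_coe_nnreal]

theorem ofReal_occCoeff {I : Type*} {w : I → ℝ≥0} (hs : Summable fun i => (w i : ℝ)) (s : I → ℕ)
    (m : ℕ) :
    ENNReal.ofReal (occCoeff (fun i => (w i : ℝ)) s m) =
      ∑' r : {r : I →₀ ℕ // occSize s r = m}, ((occWeight w r.1 : ℝ≥0) : ℝ≥0∞) := by
  have h0 : Summable (occWeight fun i => (w i : ℝ)) :=
    summable_occWeight_real (fun i => NNReal.coe_nonneg _) hs
  have h1 : Summable fun r : {r : I →₀ ℕ // occSize s r = m} =>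
      occWeight (fun i => (w i : ℝ)) r.1 := h0.comp_injective Subtype.val_injective
  simp_rw [← ofReal_occWeight_nnreal]
  exact ENNReal.ofReal_tsum_of_nonneg
    (fun r => occWeight_nonneg (fun i => NNReal.coe_nonneg _) r.1) h1

/-- The link between model and probability: up to normalization, H_0 = k has weight h_k times the
off-origin coefficient at n - k. `F = 1` gives the partition function, and indicators give the law
of H_0. -/
theorem tsum_weight_mul {d : ℕ} {δ : ℝ} (hδ : 0 < δ) {θ : ℕ → ℝ≥0} {L : ℝ}
    (hs : Summable (offWeight (trap d δ) θ L)) (n : ℕ) (F : ℕ → ℝ≥0∞) :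
    ∑' l : SpatialPartition d n, (weight (trap d δ) θ L l : ℝ≥0∞) * F (originOccupation l) =
      ∑ k ∈ Finset.range (n + 1), ENNReal.ofReal
        (h θ k * occCoeff (offWeight (trap d δ) θ L) offSize (n - k)) * F k := by
  rw [← (Equiv.ofBijective _ (bijective_ofMult d n)).tsum_eq,
    ← ((glueMult d).subtypeEquiv (p := fun t => occSize (fun j : ℕ+ => (j : ℕ)) t.1 +
      occSize offSize t.2 = n) fun t => by rw [occSize_glueMult]; rfl).tsum_eq]
  have := tsum_convolution (occSize (fun j : ℕ+ => (j : ℕ))) (occSize (offSize (d := d)))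
    (fun p => ((occWeight (fun j : ℕ+ => θ j / (j : ℝ≥0)) p : ℝ≥0) : ℝ≥0∞))
    (fun r => ((occWeight (fun i : OffIndex d => siteWeight (trap d δ) θ L i.1 i.2) r : ℝ≥0) :
      ℝ≥0∞)) F n
  simp_rw [← h_eq_tsum, ← ofReal_occCoeff (w := fun i : OffIndex d =>
    siteWeight (trap d δ) θ L i.1 i.2) hs] at this
  refine Eq.trans (tsum_congr fun t => ?_) (this.trans (Finset.sum_congr rfl fun k _ => ?_))
  · obtain ⟨⟨p, r⟩, ht⟩ := t
    simp only [Equiv.ofBijective_apply, Equiv.subtypeEquiv_apply, weight_ofMult,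
      originOccupation_ofMult, curry_glueMult_zero, occWeight_glueMult,
      siteWeight_trap_zero hδ, ENNReal.coe_mul]
  · rw [ENNReal.ofReal_mul (h_nonneg θ k)]
    rfl

end SpatialPartitions

/-! ### Lattice sums of Boltzmann factors as integrals over cells. -/

namespace SpatialPartitions

section LatticeSums

variable {d : ℕ} {δ : ℝ}

theorem integrable_exp_trap (hδ : 0 < δ) (hδd : δ < d) {β : ℝ} (hβ : 0 < β) :
    Integrable fun x : EuclideanSpace ℝ (Fin d) => Real.exp (-(β * trap d δ x)) := by
  have hd : 0 < d := by exact_mod_cast hδ.trans hδd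
  have : Nonempty (Fin d) := ⟨⟨0, hd⟩⟩
  refine (integrable_fun_norm_addHaar (volume : Measure (EuclideanSpace ℝ (Fin d)))
    (f := fun r => Real.exp (-(β * r ^ δ)))).2 ?_
  have h := integrableOn_rpow_mul_exp_neg_mul_rpow (s := (d : ℝ) - 1) (p := δ) (b := β)
    (by have : (0 : ℝ) < d := by exact_mod_cast hd
        linarith) hδ hβ
  refine h.congr_fun (fun r hr => ?_) measurableSet_Ioi
  simp only [finrank_euclideanSpace, Fintype.card_fin, smul_eq_mul]
  rw [← Real.rpow_natCast, Nat.cast_sub (by omega), Nat.cast_one, neg_mul]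

/-- In polar coordinates the integral is an explicit Gamma value times `β ^ (-d/δ)`; comparison with
`β = 1` removes the constant. -/
theorem integral_exp_trap (hδ : 0 < δ) (hδd : δ < d) {β : ℝ} (hβ : 0 < β) :
    ∫ x : EuclideanSpace ℝ (Fin d), Real.exp (-(β * trap d δ x)) =
      (∫ x : EuclideanSpace ℝ (Fin d), Real.exp (-trap d δ x)) * β ^ (-((d : ℝ) / δ)) := by
  have hd : 0 < d := by exact_mod_cast hδ.trans hδd
  have : Nonempty (Fin d) := ⟨⟨0, hd⟩⟩
  have key : ∀ b : ℝ, 0 < b → ∫ x : EuclideanSpace ℝ (Fin d), Real.exp (-(b * trap d δ x)) =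
      (d * (volume.real (Metric.ball (0 : EuclideanSpace ℝ (Fin d)) 1)) *
        ((1 / δ) * Real.Gamma (d / δ))) * b ^ (-((d : ℝ) / δ)) := by
    intro b hb
    have h1 := integral_fun_norm_addHaar (volume : Measure (EuclideanSpace ℝ (Fin d)))
      (fun r => Real.exp (-(b * r ^ δ)))
    have h2 := integral_rpow_mul_exp_neg_mul_rpow (p := δ) (q := (d : ℝ) - 1) (b := b) hδ
      (by have : (0 : ℝ) < d := by exact_mod_cast hd
          linarith) hb
    have h3 : ∫ y in Set.Ioi (0 : ℝ), y ^ (d - 1) • Real.exp (-(b * y ^ δ)) =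
        ∫ y in Set.Ioi (0 : ℝ), y ^ ((d : ℝ) - 1) * Real.exp (-b * y ^ δ) := by
      refine setIntegral_congr_fun measurableSet_Ioi fun r hr => ?_
      simp only [smul_eq_mul]
      rw [← Real.rpow_natCast, Nat.cast_sub (by omega), Nat.cast_one, neg_mul]
    simp only [finrank_euclideanSpace, Fintype.card_fin] at h1
    rw [h3, h2] at h1
    refine h1.trans ?_
    simp only [nsmul_eq_mul, smul_eq_mul, sub_add_cancel, neg_div]
    ring
  have k1 := key 1 one_pos
  simp only [one_mul, Real.one_rpow, mul_one] at k1
  rw [key β hβ, k1]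

theorem integral_exp_trap_pos (hδ : 0 < δ) (hδd : δ < d) :
    0 < ∫ x : EuclideanSpace ℝ (Fin d), Real.exp (-trap d δ x) := by
  have h := integrable_exp_trap hδ hδd one_pos
  simp only [one_mul] at h
  exact integral_exp_pos h

theorem boltzmannIntegral_eq (hδ : 0 < δ) (hδd : δ < d) (j : ℕ+) :
    boltzmannIntegral (trap d δ) j = ENNReal.ofReal
      ((∫ x : EuclideanSpace ℝ (Fin d), Real.exp (-trap d δ x)) *
        ((j : ℕ) : ℝ) ^ (-((d : ℝ) / δ))) := by
  have hj : (0 : ℝ) < ((j : ℕ) : ℝ) := by exact_mod_cast j.2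
  rw [← integral_exp_trap hδ hδd hj, ofReal_integral_eq_lintegral_ofReal
    (integrable_exp_trap hδ hδd hj) (ae_of_all _ fun x => (Real.exp_pos _).le)]
  rfl

/-- The site of the cell of the lattice `L⁻¹ ℤ^d` which contains a point. -/
noncomputable def cellSite (L : ℝ) (y : EuclideanSpace ℝ (Fin d)) : Site d := fun i => ⌊L * y i⌋

theorem measurable_cellSite (L : ℝ) : Measurable (cellSite (d := d) L) := by
  refine measurable_pi_iff.2 fun i => ?_
  exact Int.measurable_floor.comp (by fun_prop)

theorem volume_cellSite_preimage {L : ℝ} (hL : 0 < L) (x : Site d) :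
    volume (cellSite L ⁻¹' {x}) = ENNReal.ofReal (L ^ d)⁻¹ := by
  have h1 : cellSite L ⁻¹' {x} = (WithLp.ofLp : EuclideanSpace ℝ (Fin d) → Fin d → ℝ) ⁻¹'
      (Set.pi Set.univ fun i => Set.Ico ((x i : ℝ) / L) (((x i : ℝ) + 1) / L)) := by
    ext y
    simp only [Set.mem_preimage, Set.mem_singleton_iff, funext_iff, cellSite, Int.floor_eq_iff,
      Set.mem_univ_pi, Set.mem_Ico]
    refine forall_congr' fun i => ?_
    rw [div_le_iff₀ hL, lt_div_iff₀ hL, mul_comm L]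
  rw [h1, (PiLp.volume_preserving_ofLp (Fin d)).measure_preimage
    (MeasurableSet.univ_pi fun i => measurableSet_Ico).nullMeasurableSet, Real.volume_pi_Ico]
  have : ∀ i, ((x i : ℝ) + 1) / L - (x i : ℝ) / L = L⁻¹ := fun i => by field_simp; ring
  simp_rw [this]
  rw [Finset.prod_const, Finset.card_univ, Fintype.card_fin, ← ENNReal.ofReal_pow (by positivity),
    inv_pow]

theorem norm_sub_scaledSite_cellSite_le {L : ℝ} (hL : 0 < L) (y : EuclideanSpace ℝ (Fin d)) :
    ‖y - scaledSite L (cellSite L y)‖ ≤ √d / L := by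
  rw [EuclideanSpace.norm_eq, Real.sqrt_le_left (by positivity), div_pow, Real.sq_sqrt (by positivity)]
  calc ∑ i, ‖(y - scaledSite L (cellSite L y)) i‖ ^ 2 ≤ ∑ _i : Fin d, (1 / L) ^ 2 := by
        refine Finset.sum_le_sum fun i _ => ?_
        have h1 : (y - scaledSite L (cellSite L y)) i = Int.fract (L * y i) / L := by
          simp only [scaledSite, cellSite, PiLp.sub_apply, Int.fract]
          field_simp
        rw [h1, norm_div, Real.norm_of_nonneg hL.le, Real.norm_of_nonneg (Int.fract_nonneg _)]
        gcongr
        exact (Int.fract_lt_one _).le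
    _ = d / L ^ 2 := by simp; ring

theorem one_div_le_norm_scaledSite {L : ℝ} (hL : 0 < L) {x : Site d} (hx : x ≠ 0) :
    1 / L ≤ ‖scaledSite L x‖ := by
  obtain ⟨i, hi⟩ := Function.ne_iff.1 hx
  refine le_trans ?_ (PiLp.norm_apply_le (scaledSite L x) i)
  simp only [scaledSite, norm_div, Real.norm_of_nonneg hL.le]
  gcongr
  rw [Real.norm_eq_abs]
  exact_mod_cast Int.one_le_abs hi

/-- The energy gap: a nonzero site has a coordinate of absolute value at least 1. This gap is what
leaves M with some exponential moments at the critical fugacity. -/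
theorem rpow_neg_le_trap_scaledSite (hδ : 0 < δ) {L : ℝ} (hL : 0 < L) {x : Site d} (hx : x ≠ 0) :
    L ^ (-δ) ≤ trap d δ (scaledSite L x) := by
  have := Real.rpow_le_rpow (by positivity) (one_div_le_norm_scaledSite hL hx) hδ.le
  rwa [one_div, Real.inv_rpow hL.le, ← Real.rpow_neg hL.le] at this

/-- The rounding error is at most `√d / L`, and outside the cell of the origin `1 / L` is at most
the norm of the site. The resulting comparison of norms is uniform in `L`, and so provides an
integrable majorant. -/
theorem norm_le_of_cellSite_ne_zero {L : ℝ} (hL : 0 < L) {y : EuclideanSpace ℝ (Fin d)}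
    (hy : cellSite L y ≠ 0) : (1 + √d)⁻¹ * ‖y‖ ≤ ‖scaledSite L (cellSite L y)‖ := by
  have h1 := norm_sub_scaledSite_cellSite_le hL y
  have h2 := one_div_le_norm_scaledSite hL hy
  have h3 := norm_le_norm_add_norm_sub' y (scaledSite L (cellSite L y))
  rw [inv_mul_le_iff₀ (by positivity)]
  have h4 : √d / L ≤ √d * ‖scaledSite L (cellSite L y)‖ := by
    rw [div_eq_mul_one_div]; gcongr
  nlinarith

/-- The Boltzmann factor of the lattice cell of a point, if it is not the cell of the origin. -/
noncomputable def cellBoltzmann (δ L β : ℝ) (y : EuclideanSpace ℝ (Fin d)) : ℝ :=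
  if cellSite L y = 0 then 0 else Real.exp (-(β * trap d δ (scaledSite L (cellSite L y))))

theorem cellBoltzmann_nonneg (L β : ℝ) (y : EuclideanSpace ℝ (Fin d)) :
    0 ≤ cellBoltzmann δ L β y := by
  unfold cellBoltzmann
  split_ifs
  exacts [le_rfl, (Real.exp_pos _).le]

theorem measurable_cellBoltzmann (L β : ℝ) : Measurable (cellBoltzmann (d := d) δ L β) :=
  (measurable_of_countable fun x : Site d =>
    if x = 0 then 0 else Real.exp (-(β * trap d δ (scaledSite L x)))).comp (measurable_cellSite L)

theorem cellBoltzmann_le (hδ : 0 < δ) {L β : ℝ} (hL : 0 < L) (hβ : 0 < β)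
    (y : EuclideanSpace ℝ (Fin d)) :
    cellBoltzmann δ L β y ≤ Real.exp (-(β * (1 + √d)⁻¹ ^ δ * trap d δ y)) := by
  unfold cellBoltzmann
  split_ifs with h
  · exact (Real.exp_pos _).le
  · rw [Real.exp_le_exp, neg_le_neg_iff, mul_assoc]
    gcongr
    rw [trap, ← Real.mul_rpow (by positivity) (norm_nonneg y)]
    exact Real.rpow_le_rpow (by positivity) (norm_le_of_cellSite_ne_zero hL h) hδ.le

theorem integrable_cellBoltzmann (hδ : 0 < δ) (hδd : δ < d) {L β : ℝ} (hL : 0 < L) (hβ : 0 < β) :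
    Integrable (cellBoltzmann (d := d) δ L β) := by
  refine (integrable_exp_trap hδ hδd (β := β * (1 + √d)⁻¹ ^ δ) (by positivity)).mono'
    (measurable_cellBoltzmann L β).aestronglyMeasurable (ae_of_all _ fun y => ?_)
  rw [Real.norm_of_nonneg (cellBoltzmann_nonneg L β y)]
  exact cellBoltzmann_le hδ hL hβ y

/-- Each cell has volume `L ^ (-d)`, so the sum is `L ^ d` times the integral of a step function. -/
theorem tsum_ofReal_exp_trap (hδ : 0 < δ) (hδd : δ < d) {L β : ℝ} (hL : 0 < L) (hβ : 0 < β) :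
    ∑' x : {x : Site d // x ≠ 0}, ENNReal.ofReal (Real.exp (-(β * trap d δ (scaledSite L x)))) =
      ENNReal.ofReal (L ^ d * ∫ y, cellBoltzmann (d := d) δ L β y) := by
  set g : Site d → ℝ≥0∞ := {x : Site d | x ≠ 0}.indicator
    fun x => ENNReal.ofReal (Real.exp (-(β * trap d δ (scaledSite L x)))) with hg
  have h1 : ∀ y, ENNReal.ofReal (cellBoltzmann δ L β y) = g (cellSite L y) := by
    intro y
    by_cases h : cellSite L y = 0 <;> simp [cellBoltzmann, hg, h]
  have h2 : ∑' x, g x * ENNReal.ofReal (L ^ d)⁻¹ =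
      ENNReal.ofReal (∫ y, cellBoltzmann (d := d) δ L β y) := by
    rw [ofReal_integral_eq_lintegral_ofReal (integrable_cellBoltzmann hδ hδd hL hβ)
      (ae_of_all _ fun y => cellBoltzmann_nonneg L β y)]
    simp_rw [h1]
    rw [← lintegral_map (measurable_of_countable g) (measurable_cellSite L), lintegral_countable']
    refine tsum_congr fun x => ?_
    rw [Measure.map_apply (measurable_cellSite L) (measurableSet_singleton x),
      volume_cellSite_preimage hL]
  have hLd : (0 : ℝ) < L ^ d := by positivity
  rw [ENNReal.ofReal_mul hLd.le, ← h2, ENNReal.tsum_mul_right, mul_comm, mul_assoc,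
    ← ENNReal.ofReal_mul (by positivity), inv_mul_cancel₀ hLd.ne', ENNReal.ofReal_one, mul_one]
  exact tsum_subtype {x : Site d | x ≠ 0}
    fun x => ENNReal.ofReal (Real.exp (-(β * trap d δ (scaledSite L x))))

theorem hasSum_exp_trap (hδ : 0 < δ) (hδd : δ < d) {L β : ℝ} (hL : 0 < L) (hβ : 0 < β) :
    HasSum (fun x : {x : Site d // x ≠ 0} => Real.exp (-(β * trap d δ (scaledSite L x))))
      (L ^ d * ∫ y, cellBoltzmann (d := d) δ L β y) := by
  have h := tsum_ofReal_exp_trap hδ hδd hL hβ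
  have hs : Summable fun x : {x : Site d // x ≠ 0} =>
      Real.exp (-(β * trap d δ (scaledSite L x))) := by
    have := ENNReal.summable_toReal (h.trans_ne ENNReal.ofReal_ne_top)
    simpa only [ENNReal.toReal_ofReal (Real.exp_pos _).le] using this
  have hnn : 0 ≤ L ^ d * ∫ y, cellBoltzmann (d := d) δ L β y :=
    mul_nonneg (by positivity) (integral_nonneg fun y => cellBoltzmann_nonneg L β y)
  rw [← ENNReal.ofReal_tsum_of_nonneg (fun x => (Real.exp_pos _).le) hs,
    ENNReal.ofReal_eq_ofReal_iff (tsum_nonneg fun x => (Real.exp_pos _).le) hnn] at h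
  rw [← h]
  exact hs.hasSum

/-- A bound for the integrals of the Boltzmann factors of lattice cells. -/
noncomputable def cellConst (d : ℕ) (δ : ℝ) : ℝ :=
  ∫ x : EuclideanSpace ℝ (Fin d), Real.exp (-((1 + √d)⁻¹ ^ δ * trap d δ x))

theorem cellConst_nonneg (d : ℕ) (δ : ℝ) : 0 ≤ cellConst d δ :=
  integral_nonneg fun _ => (Real.exp_pos _).le

theorem integral_cellBoltzmann_nonneg (L β : ℝ) :
    0 ≤ ∫ y, cellBoltzmann (d := d) δ L β y :=
  integral_nonneg fun y => cellBoltzmann_nonneg L β y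

theorem integral_cellBoltzmann_le (hδ : 0 < δ) (hδd : δ < d) {L β : ℝ} (hL : 0 < L) (hβ : 0 < β) :
    ∫ y, cellBoltzmann (d := d) δ L β y ≤ cellConst d δ * β ^ (-((d : ℝ) / δ)) := by
  have hκ : 0 < (1 + √d)⁻¹ ^ δ := by positivity
  calc ∫ y, cellBoltzmann (d := d) δ L β y
      ≤ ∫ y, Real.exp (-(β * (1 + √d)⁻¹ ^ δ * trap d δ y)) :=
        integral_mono (integrable_cellBoltzmann hδ hδd hL hβ)
          (integrable_exp_trap hδ hδd (by positivity)) (cellBoltzmann_le hδ hL hβ)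
    _ = _ := by
        rw [cellConst, integral_exp_trap hδ hδd hκ, integral_exp_trap hδ hδd (by positivity),
          Real.mul_rpow hβ.le hκ.le]
        ring

theorem tendsto_cellBoltzmann (hδ : 0 < δ) (β : ℝ) {y : EuclideanSpace ℝ (Fin d)} (hy : y ≠ 0) :
    Tendsto (fun L => cellBoltzmann δ L β y) atTop (𝓝 (Real.exp (-(β * trap d δ y)))) := by
  have h0 : Tendsto (fun L : ℝ => √d / L) atTop (𝓝 0) := tendsto_const_nhds.div_atTop tendsto_id
  have h1 : Tendsto (fun L => scaledSite L (cellSite L y)) atTop (𝓝 y) := by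
    rw [tendsto_iff_norm_sub_tendsto_zero]
    refine squeeze_zero' (Eventually.of_forall fun _ => norm_nonneg _) ?_ h0
    filter_upwards [eventually_gt_atTop 0] with L hL
    rw [norm_sub_rev]
    exact norm_sub_scaledSite_cellSite_le hL y
  have hc : Continuous fun y : EuclideanSpace ℝ (Fin d) => Real.exp (-(β * trap d δ y)) := by
    unfold trap
    exact Real.continuous_exp.comp
      ((continuous_const.mul (continuous_norm.rpow_const fun _ => Or.inr hδ.le)).neg)
  refine ((hc.tendsto y).comp h1).congr' ?_
  filter_upwards [h1.eventually_ne hy] with L hL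
  rw [cellBoltzmann, if_neg]
  · rfl
  · intro h
    rw [h] at hL
    exact hL (by ext i; simp [scaledSite])

/-- Dominated convergence; the omitted cell shrinks to the null set `{0}`. -/
theorem tendsto_integral_cellBoltzmann (hδ : 0 < δ) (hδd : δ < d) {β : ℝ} (hβ : 0 < β) :
    Tendsto (fun L => ∫ y, cellBoltzmann (d := d) δ L β y) atTop
      (𝓝 ((∫ x : EuclideanSpace ℝ (Fin d), Real.exp (-trap d δ x)) * β ^ (-((d : ℝ) / δ)))) := by
  have hd : 0 < d := by exact_mod_cast hδ.trans hδd
  have : Nonempty (Fin d) := ⟨⟨0, hd⟩⟩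
  rw [← integral_exp_trap hδ hδd hβ]
  refine tendsto_integral_filter_of_dominated_convergence
    (fun y => Real.exp (-(β * (1 + √d)⁻¹ ^ δ * trap d δ y)))
    (Eventually.of_forall fun L => (measurable_cellBoltzmann L β).aestronglyMeasurable) ?_
    (integrable_exp_trap hδ hδd (by positivity)) ?_
  · filter_upwards [eventually_gt_atTop 0] with L hL
    refine ae_of_all _ fun y => ?_
    rw [Real.norm_of_nonneg (cellBoltzmann_nonneg L β y)]
    exact cellBoltzmann_le hδ hL hβ y
  · filter_upwards [compl_mem_ae_iff.2 (measure_singleton (0 : EuclideanSpace ℝ (Fin d)))] with y hy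
    exact tendsto_cellBoltzmann hδ β hy

end LatticeSums

end SpatialPartitions

/-! ### The compound Poisson law: transforms and tails. -/

namespace SpatialPartitions

/-- The law of the total size `∑_i s_i R_i` for independent Poisson variables `R_i` with
parameters `w_i`. -/
noncomputable def compoundProb {I : Type*} (w : I → ℝ) (s : I → ℕ) (m : ℕ) : ℝ :=
  Real.exp (-∑' i, w i) * occCoeff w s m

theorem compoundProb_nonneg {I : Type*} {w : I → ℝ} (h0 : ∀ i, 0 ≤ w i) (s : I → ℕ) (m : ℕ) :
    0 ≤ compoundProb w s m := mul_nonneg (Real.exp_pos _).le (occCoeff_nonneg h0 s m)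

/-- Normalization and centring subtract the first two Taylor terms from the exponential in each
summand. With complex `z`, one identity yields characteristic functions, exponential moments and, at
`z = 0`, the total mass. -/
theorem hasSum_compoundProb_cexp {I : Type*} {w : I → ℝ} {s : I → ℕ} (hw : Summable w)
    (hws : Summable fun i => w i * s i) (z : ℂ)
    (hz : Summable fun i => ‖(w i : ℂ) * Complex.exp (z * s i)‖) :
    HasSum (fun m : ℕ => (compoundProb w s m : ℂ) * Complex.exp (z * (m - (∑' i, w i * s i : ℝ))))
      (Complex.exp (∑' i, (w i : ℂ) * (Complex.exp (z * s i) - 1 - z * s i))) := by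
  have h := (hasSum_occCoeff s z hz).mul_left
    (Complex.exp (-(∑' i, w i : ℝ)) * Complex.exp (-(z * (∑' i, w i * s i : ℝ))))
  have hw' : HasSum (fun i => (w i : ℂ)) ((∑' i, w i : ℝ) : ℂ) :=
    Complex.hasSum_ofReal.2 hw.hasSum
  have hws' : HasSum (fun i => ((w i * s i : ℝ) : ℂ)) ((∑' i, w i * s i : ℝ) : ℂ) :=
    Complex.hasSum_ofReal.2 hws.hasSum
  have hsum := (hz.of_norm.hasSum.sub hw').sub (hws'.mul_left z)
  have hfun : (fun i => (w i : ℂ) * Complex.exp (z * s i) - w i - z * ((w i * s i : ℝ) : ℂ)) =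
      fun i => (w i : ℂ) * (Complex.exp (z * s i) - 1 - z * s i) := by
    funext i; push_cast; ring
  rw [hfun] at hsum
  rw [hsum.tsum_eq]
  convert! h using 1
  · funext m
    rw [compoundProb, mul_sub, Complex.exp_sub, Complex.exp_neg (z * _)]
    push_cast
    ring
  · rw [← Complex.exp_add, ← Complex.exp_add]
    congr 1
    ring

theorem hasSum_compoundProb_exp {I : Type*} {w : I → ℝ} {s : I → ℕ} (h0 : ∀ i, 0 ≤ w i)
    (hw : Summable w) (hws : Summable fun i => w i * s i) (t : ℝ)
    (ht : Summable fun i => w i * Real.exp (t * s i)) :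
    HasSum (fun m : ℕ => compoundProb w s m * Real.exp (t * (m - ∑' i, w i * s i)))
      (Real.exp (∑' i, w i * (Real.exp (t * s i) - 1 - t * s i))) := by
  have h := hasSum_compoundProb_cexp hw hws (t : ℂ) (by
    refine ht.congr fun i => ?_
    rw [norm_mul, Complex.norm_of_nonneg (h0 i), Complex.norm_exp]
    simp)
  rw [← Complex.hasSum_ofReal]
  push_cast
  convert! h using 2
  push_cast
  rfl

theorem hasSum_compoundProb {I : Type*} {w : I → ℝ} {s : I → ℕ} (h0 : ∀ i, 0 ≤ w i)
    (hw : Summable w) (hws : Summable fun i => w i * s i) :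
    HasSum (compoundProb w s) 1 := by
  simpa using hasSum_compoundProb_exp h0 hw hws 0 (by simpa using hw)

/-- The mass away from the mean. -/
theorem tsum_tail_le {p : ℕ → ℝ} (hp : ∀ m, 0 ≤ p m) {μ t u A B : ℝ} (ht : 0 ≤ t)
    (hA : HasSum (fun m : ℕ => p m * Real.exp (t * (m - μ))) A)
    (hB : HasSum (fun m : ℕ => p m * Real.exp (-t * (m - μ))) B) :
    Summable (fun m : ℕ => if |(m : ℝ) - μ| ≤ u then 0 else p m) ∧
    ∑' m : ℕ, (if |(m : ℝ) - μ| ≤ u then 0 else p m) ≤ Real.exp (-(t * u)) * (A + B) := by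
  -- Chernoff in pointwise form: outside the window one of the two exponentials is at least `exp (t
  -- * u)`.
  have hle : ∀ m : ℕ, (if |(m : ℝ) - μ| ≤ u then 0 else p m) ≤ Real.exp (-(t * u)) *
      (p m * Real.exp (t * (m - μ)) + p m * Real.exp (-t * (m - μ))) := by
    intro m
    have e1 := Real.exp_pos (t * (m - μ))
    have e2 := Real.exp_pos (-t * (m - μ))
    split_ifs with hm
    · have := hp m
      positivity
    · push Not at hm
      rw [← mul_add, mul_left_comm]
      refine le_mul_of_one_le_right (hp m) ?_
      rw [Real.exp_neg, ← div_eq_inv_mul, one_le_div (Real.exp_pos _)]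
      rcases le_total 0 ((m : ℝ) - μ) with h | h
      · rw [abs_of_nonneg h] at hm
        have : Real.exp (t * u) ≤ Real.exp (t * (m - μ)) := Real.exp_le_exp.2 (by gcongr)
        linarith
      · rw [abs_of_nonpos h] at hm
        have : Real.exp (t * u) ≤ Real.exp (-t * (m - μ)) := Real.exp_le_exp.2 (by nlinarith)
        linarith
  have hsum := (hA.add hB).mul_left (Real.exp (-(t * u)))
  have hs : Summable (fun m : ℕ => if |(m : ℝ) - μ| ≤ u then 0 else p m) :=
    Summable.of_nonneg_of_le (fun m => by split_ifs <;> simp [hp]) hle hsum.summable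
  exact ⟨hs, (hs.tsum_le_tsum hle hsum.summable).trans_eq hsum.tsum_eq⟩

section

variable {d : ℕ} {δ : ℝ}

/-- Fubini over sites and part sizes, with the bound `(c j) ^ (-d/δ)` on cell integrals for
summability. The factor `c` is 1 for the true weights and 1/2 once half of the energy has been spent
on an exponential moment. -/
theorem hasSum_offIndex {E : Type*} [NormedAddCommGroup E] [NormedSpace ℝ E] [CompleteSpace E]
    (hδ : 0 < δ) (hδd : δ < d) {L c : ℝ} (hL : 0 < L) (hc : 0 < c) {u : ℕ+ → E}
    (hu : Summable fun j : ℕ+ => ((j : ℕ) : ℝ) ^ (-((d : ℝ) / δ)) * ‖u j‖) :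
    HasSum (fun i : OffIndex d =>
        Real.exp (-((c * (i.2 : ℕ)) * trap d δ (scaledSite L i.1))) • u i.2)
      (L ^ d • ∑' j : ℕ+, (∫ y, cellBoltzmann (d := d) δ L (c * (j : ℕ)) y) • u j) := by
  have hj : ∀ j : ℕ+, 0 < c * ((j : ℕ) : ℝ) := fun j => mul_pos hc (by exact_mod_cast j.2)
  have hLd : 0 < L ^ d := by positivity
  have h1 : ∀ j : ℕ+, HasSum (fun x : {x : Site d // x ≠ 0} =>
      Real.exp (-((c * (j : ℕ)) * trap d δ (scaledSite L x))) • u j)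
      ((L ^ d * ∫ y, cellBoltzmann (d := d) δ L (c * (j : ℕ)) y) • u j) :=
    fun j => (hasSum_exp_trap hδ hδd hL (hj j)).smul_const (u j)
  have h1n : ∀ j : ℕ+, HasSum (fun x : {x : Site d // x ≠ 0} =>
      ‖Real.exp (-((c * (j : ℕ)) * trap d δ (scaledSite L x))) • u j‖)
      ((L ^ d * ∫ y, cellBoltzmann (d := d) δ L (c * (j : ℕ)) y) * ‖u j‖) := by
    intro j
    simp_rw [norm_smul, Real.norm_of_nonneg (Real.exp_pos _).le]
    exact (hasSum_exp_trap hδ hδd hL (hj j)).mul_right _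
  have hs : Summable fun q : ℕ+ × {x : Site d // x ≠ 0} =>
      Real.exp (-((c * (q.1 : ℕ)) * trap d δ (scaledSite L q.2))) • u q.1 := by
    refine Summable.of_norm ((summable_prod_of_nonneg fun _ => norm_nonneg _).2
      ⟨fun j => (h1n j).summable, ?_⟩)
    simp_rw [fun j => (h1n j).tsum_eq]
    refine Summable.of_nonneg_of_le (fun j => mul_nonneg (mul_nonneg hLd.le
      (integral_cellBoltzmann_nonneg L _)) (norm_nonneg _)) (fun j => ?_)
      (hu.mul_left (L ^ d * (cellConst d δ * c ^ (-((d : ℝ) / δ)))))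
    have := integral_cellBoltzmann_le hδ hδd hL (hj j)
    rw [Real.mul_rpow hc.le (Nat.cast_nonneg _)] at this
    calc _ ≤ L ^ d * (cellConst d δ * (c ^ (-((d : ℝ) / δ)) * ((j : ℕ) : ℝ) ^ (-((d : ℝ) / δ)))) *
          ‖u j‖ := by gcongr
      _ = _ := by ring
  rw [← (Equiv.prodComm _ _).hasSum_iff]
  have h2 := hs.hasSum
  have h3 := (h2.prod_fiberwise h1).tsum_eq
  simp_rw [mul_smul] at h3
  rw [tsum_const_smul'' (L ^ d)] at h3
  rw [h3]
  exact h2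

end

end SpatialPartitions

/-! ### Mean, exponential moments and characteristic function off the origin. -/

namespace SpatialPartitions

/-- For `|x| ≤ 1` this is the Taylor bound; for `|x| > 1` the three terms add up to at most `2 + |x|
≤ 3 * x ^ 2`. Being global, the bound can serve as a majorant over all part sizes. -/
theorem norm_cexp_I_mul_sub_le (x : ℝ) :
    ‖Complex.exp (x * Complex.I) - 1 - x * Complex.I‖ ≤ 3 * x ^ 2 := by
  rcases le_or_gt |x| 1 with hx | hx
  · have h := Complex.norm_exp_sub_one_sub_id_le (x := x * Complex.I) (by simpa using hx)
    have : ‖(x : ℂ) * Complex.I‖ = |x| := by simp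
    rw [this, sq_abs] at h
    nlinarith [sq_nonneg x]
  · have h1 : ‖Complex.exp (x * Complex.I)‖ = 1 := Complex.norm_exp_ofReal_mul_I x
    have h2 : ‖(x : ℂ) * Complex.I‖ = |x| := by simp
    have h3 := norm_sub_le (Complex.exp (x * Complex.I) - 1) (x * Complex.I)
    have h4 := norm_sub_le (Complex.exp (x * Complex.I)) 1
    rw [h1, norm_one] at h4
    rw [h2] at h3
    nlinarith [sq_abs x]

theorem tendsto_mul_cexp_sub (x : ℝ) :
    Tendsto (fun A : ℝ => (A : ℂ) * (Complex.exp ((x / √A : ℝ) * Complex.I) - 1 -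
      (x / √A : ℝ) * Complex.I)) atTop (𝓝 (-(x ^ 2 / 2 : ℝ))) := by
  have h0 : Tendsto (fun A : ℝ => |x| / √A) atTop (𝓝 0) :=
    tendsto_const_nhds.div_atTop Real.tendsto_sqrt_atTop
  have h1 : Tendsto (fun A : ℝ => x ^ 2 * (|x| / √A * Real.exp (|x| / √A))) atTop (𝓝 0) := by
    simpa using (h0.mul ((Real.continuous_exp.tendsto 0).comp h0)).const_mul (x ^ 2)
  rw [tendsto_iff_norm_sub_tendsto_zero]
  refine squeeze_zero' (Eventually.of_forall fun _ => norm_nonneg _) ?_ h1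
  filter_upwards [eventually_gt_atTop 0] with A hA
  have hs : 0 < √A := Real.sqrt_pos.2 hA
  have hsq : √A ^ 2 = A := Real.sq_sqrt hA.le
  have h := Complex.norm_exp_sub_sum_le_norm_mul_exp ((x / √A : ℝ) * Complex.I) 3
  have hn : ‖((x / √A : ℝ) : ℂ) * Complex.I‖ = |x| / √A := by
    rw [norm_mul, Complex.norm_I, mul_one, Complex.norm_real, Real.norm_eq_abs, abs_div,
      abs_of_pos hs]
  rw [hn] at h
  have he : (A : ℂ) * (Complex.exp ((x / √A : ℝ) * Complex.I) - 1 - (x / √A : ℝ) * Complex.I) -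
      (-(x ^ 2 / 2 : ℝ) : ℂ) = A * (Complex.exp ((x / √A : ℝ) * Complex.I) -
        ∑ m ∈ Finset.range 3, ((x / √A : ℝ) * Complex.I) ^ m / (m ! : ℂ)) := by
    have h2 : (A : ℂ) * ((x / √A : ℝ) : ℂ) ^ 2 = (x : ℂ) ^ 2 := by
      rw [← Complex.ofReal_pow, ← Complex.ofReal_mul, div_pow, hsq, mul_div_cancel₀ _ hA.ne',
        Complex.ofReal_pow]
    simp only [Finset.sum_range_succ, Finset.sum_range_zero, Nat.factorial, mul_pow, Complex.I_sq]
    push_cast at h2 ⊢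
    linear_combination (-1 / 2 : ℂ) * h2
  rw [he, norm_mul, Complex.norm_real, Real.norm_of_nonneg hA.le]
  calc A * _ ≤ A * ((|x| / √A) ^ 3 * Real.exp (|x| / √A)) := by gcongr
    _ = √A ^ 2 * ((|x| / √A) ^ 3 * Real.exp (|x| / √A)) := by rw [hsq]
    _ = |x| ^ 2 * (|x| / √A * Real.exp (|x| / √A)) := by field_simp
    _ = _ := by rw [sq_abs]

theorem exp_sub_one_sub_le (x : ℝ) : Real.exp x - 1 - x ≤ x ^ 2 * Real.exp |x| := by
  have h := Complex.norm_exp_sub_sum_le_norm_mul_exp (x : ℂ) 2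
  simp only [Finset.sum_range_succ, Finset.sum_range_zero, Nat.factorial, pow_zero, pow_one,
    Complex.norm_real, Real.norm_eq_abs, sq_abs] at h
  refine le_trans (le_trans (le_abs_self _) (le_of_eq ?_)) h
  rw [← Real.norm_eq_abs, ← Complex.norm_real]
  push_cast
  ring_nf

section

variable {d : ℕ} {δ : ℝ} {θ : ℕ → ℝ≥0}

theorem offWeight_trap_eq (L : ℝ) (i : OffIndex d) :
    offWeight (trap d δ) θ L i =
      Real.exp (-((1 * (i.2 : ℕ)) * trap d δ (scaledSite L i.1))) * (θ i.2 / (i.2 : ℕ)) := by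
  rw [offWeight, siteWeight, NNReal.coe_mul, Real.coe_toNNReal _ (Real.exp_pos _).le, one_mul,
    mul_comm]
  simp

/-- The Boltzmann weights `θ_j j ^ (1 - d / δ)`, which are summable at criticality. -/
def CritSummable (d : ℕ) (δ : ℝ) (θ : ℕ → ℝ≥0) : Prop :=
  Summable fun j : ℕ+ => ((j : ℕ) : ℝ) ^ (-((d : ℝ) / δ)) * (((j : ℕ) : ℝ) * θ j)

/-- Quadratic growth is what the hypothesis can pay for: `θ_j / j * j ^ 2 = j * θ_j`. Masses, means
and second-order Taylor remainders all fall under it. -/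
theorem CritSummable.of_le {E : Type*} [NormedAddCommGroup E] [NormedSpace ℝ E]
    (hT : CritSummable d δ θ) {K : ℝ} {f : ℕ+ → E} (hf : ∀ j, ‖f j‖ ≤ K * ((j : ℕ) : ℝ) ^ 2) :
    Summable fun j : ℕ+ => ((j : ℕ) : ℝ) ^ (-((d : ℝ) / δ)) *
      ‖((θ j : ℝ) / ((j : ℕ) : ℝ)) • f j‖ := by
  refine Summable.of_nonneg_of_le (fun j => by positivity) (fun j => ?_) (hT.mul_left K)
  have hj : (0 : ℝ) < ((j : ℕ) : ℝ) := by exact_mod_cast j.2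
  rw [norm_smul, Real.norm_of_nonneg (by positivity)]
  calc _ ≤ ((j : ℕ) : ℝ) ^ (-((d : ℝ) / δ)) *
        ((θ j : ℝ) / ((j : ℕ) : ℝ) * (K * ((j : ℕ) : ℝ) ^ 2)) := by gcongr; exact hf j
    _ = _ := by field_simp

theorem hasSum_offWeight_smul {E : Type*} [NormedAddCommGroup E] [NormedSpace ℝ E]
    [CompleteSpace E] (hδ : 0 < δ) (hδd : δ < d) (hT : CritSummable d δ θ) {L : ℝ} (hL : 0 < L)
    {K : ℝ} {f : ℕ+ → E} (hf : ∀ j, ‖f j‖ ≤ K * ((j : ℕ) : ℝ) ^ 2) :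
    HasSum (fun i : OffIndex d => offWeight (trap d δ) θ L i • f i.2)
      (L ^ d • ∑' j : ℕ+, (∫ y, cellBoltzmann (d := d) δ L (j : ℕ) y) •
        (((θ j : ℝ) / ((j : ℕ) : ℝ)) • f j)) := by
  have h := hasSum_offIndex hδ hδd hL one_pos (hT.of_le hf)
  simp_rw [one_mul] at h
  convert! h using 2 with i
  rw [offWeight_trap_eq, mul_smul, one_mul]

/-- Dominated convergence over part sizes; `f` may depend on `L`, so that rescaled Taylor remainders
are covered. -/
theorem tendsto_tsum_cellBoltzmann {E : Type*} [NormedAddCommGroup E] [NormedSpace ℝ E]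
    [CompleteSpace E] (hδ : 0 < δ) (hδd : δ < d) (hT : CritSummable d δ θ)
    {K : ℝ} {f : ℝ → ℕ+ → E} {g : ℕ+ → E} (hf : ∀ L j, 0 < L → ‖f L j‖ ≤ K * ((j : ℕ) : ℝ) ^ 2)
    (hfg : ∀ j, Tendsto (fun L => f L j) atTop (𝓝 (g j))) :
    Tendsto (fun L => ∑' j : ℕ+, (∫ y, cellBoltzmann (d := d) δ L (j : ℕ) y) •
        (((θ j : ℝ) / ((j : ℕ) : ℝ)) • f L j)) atTop
      (𝓝 (∑' j : ℕ+, ((∫ x : EuclideanSpace ℝ (Fin d), Real.exp (-trap d δ x)) *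
        ((j : ℕ) : ℝ) ^ (-((d : ℝ) / δ))) • (((θ j : ℝ) / ((j : ℕ) : ℝ)) • g j))) := by
  have hj : ∀ j : ℕ+, (0 : ℝ) < ((j : ℕ) : ℝ) := fun j => by exact_mod_cast j.2
  refine tendsto_tsum_of_dominated_convergence
    (bound := fun j : ℕ+ => cellConst d δ * K *
      (((j : ℕ) : ℝ) ^ (-((d : ℝ) / δ)) * (((j : ℕ) : ℝ) * θ j))) (hT.mul_left _)
    (fun j => (tendsto_integral_cellBoltzmann hδ hδd (hj j)).smul ((hfg j).const_smul _)) ?_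
  filter_upwards [eventually_gt_atTop 0] with L hL j
  have := hj j
  have h1 := integral_cellBoltzmann_le hδ hδd hL (hj j)
  have h2 := integral_cellBoltzmann_nonneg (d := d) (δ := δ) L ((j : ℕ) : ℝ)
  rw [norm_smul, norm_smul, Real.norm_of_nonneg h2,
    Real.norm_of_nonneg (by positivity : (0 : ℝ) ≤ θ j / ((j : ℕ) : ℝ))]
  calc _ ≤ (cellConst d δ * ((j : ℕ) : ℝ) ^ (-((d : ℝ) / δ))) *
        ((θ j : ℝ) / ((j : ℕ) : ℝ) * (K * ((j : ℕ) : ℝ) ^ 2)) := by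
        gcongr
        · exact mul_nonneg (cellConst_nonneg d δ) (by positivity)
        · exact hf L j hL
    _ = _ := by field_simp

/-- The mean number of particles away from the origin. -/
noncomputable def offMean (d : ℕ) (δ : ℝ) (θ : ℕ → ℝ≥0) (L : ℝ) : ℝ :=
  ∑' i : OffIndex d, offWeight (trap d δ) θ L i * offSize i

theorem one_le_coe_pnat (j : ℕ+) : (1 : ℝ) ≤ ((j : ℕ) : ℝ) := by exact_mod_cast j.2

theorem coe_pnat_le_sq (j : ℕ+) : ((j : ℕ) : ℝ) ≤ ((j : ℕ) : ℝ) ^ 2 := by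
  nlinarith [one_le_coe_pnat j]

theorem summable_offWeight (hδ : 0 < δ) (hδd : δ < d) (hT : CritSummable d δ θ) {L : ℝ}
    (hL : 0 < L) : Summable (offWeight (trap d δ) θ L) := by
  have := hasSum_offWeight_smul (f := fun _ => (1 : ℝ)) hδ hδd hT hL (K := 1)
    fun j => by rw [norm_one, one_mul]; exact one_le_pow₀ (one_le_coe_pnat j)
  simpa using this.summable

theorem hasSum_offWeight_mul_offSize (hδ : 0 < δ) (hδd : δ < d) (hT : CritSummable d δ θ) {L : ℝ}
    (hL : 0 < L) : HasSum (fun i : OffIndex d => offWeight (trap d δ) θ L i * offSize i)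
      (L ^ d • ∑' j : ℕ+, (∫ y, cellBoltzmann (d := d) δ L (j : ℕ) y) •
        (((θ j : ℝ) / ((j : ℕ) : ℝ)) • ((j : ℕ) : ℝ))) :=
  hasSum_offWeight_smul (f := fun j => ((j : ℕ) : ℝ)) hδ hδd hT hL (K := 1)
    fun j => by simpa using coe_pnat_le_sq j

theorem tendsto_offMean_div (hδ : 0 < δ) (hδd : δ < d) (hT : CritSummable d δ θ) :
    Tendsto (fun L => offMean d δ θ L / L ^ d) atTop
      (𝓝 (∑' j : ℕ+, ((∫ x : EuclideanSpace ℝ (Fin d), Real.exp (-trap d δ x)) *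
        ((j : ℕ) : ℝ) ^ (-((d : ℝ) / δ))) * θ j)) := by
  have h := tendsto_tsum_cellBoltzmann (f := fun _ j => ((j : ℕ) : ℝ)) (g := fun j => ((j : ℕ) : ℝ))
    hδ hδd hT (K := 1) (fun _ j _ => by simpa using coe_pnat_le_sq j) fun j => tendsto_const_nhds
  have h' : ∀ j : ℕ+, ((θ j : ℝ) / ((j : ℕ) : ℝ)) * ((j : ℕ) : ℝ) = θ j := fun j =>
    div_mul_cancel₀ _ (by have := one_le_coe_pnat j; positivity)
  simp only [smul_eq_mul, h'] at h
  refine h.congr' ?_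
  filter_upwards [eventually_gt_atTop 0] with L hL
  rw [offMean, (hasSum_offWeight_mul_offSize hδ hδd hT hL).tsum_eq]
  simp only [smul_eq_mul, h']
  field_simp

/-- By the energy gap, half of the energy `j V(x/L)` is at least `j L^{-δ} / 2`, which absorbs `exp
(t j)`. -/
theorem offWeight_mul_exp_le (hδ : 0 < δ) {L : ℝ} (hL : 0 < L) {t : ℝ} (ht : t ≤ L ^ (-δ) / 2)
    (i : OffIndex d) :
    offWeight (trap d δ) θ L i * Real.exp (t * offSize i) ≤
      Real.exp (-((1 / 2 * (i.2 : ℕ)) * trap d δ (scaledSite L i.1))) * (θ i.2 / (i.2 : ℕ)) := by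
  rw [offWeight_trap_eq, mul_right_comm, ← Real.exp_add]
  gcongr
  have h1 := rpow_neg_le_trap_scaledSite hδ hL i.1.2
  have h2 := one_le_coe_pnat i.2
  simp only [offSize]
  nlinarith

/-- A bound for the logarithmic moment generating function, in units of `t² L ^ d`. -/
noncomputable def momentConst (d : ℕ) (δ : ℝ) (θ : ℕ → ℝ≥0) : ℝ :=
  cellConst d δ * (1 / 2 : ℝ) ^ (-((d : ℝ) / δ)) *
    ∑' j : ℕ+, ((j : ℕ) : ℝ) ^ (-((d : ℝ) / δ)) * (((j : ℕ) : ℝ) * θ j)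

theorem hasSum_half (hδ : 0 < δ) (hδd : δ < d) (hT : CritSummable d δ θ) {L : ℝ} (hL : 0 < L) :
    ∃ S ≤ L ^ d * momentConst d δ θ, HasSum (fun i : OffIndex d =>
      Real.exp (-((1 / 2 * (i.2 : ℕ)) * trap d δ (scaledSite L i.1))) * ((i.2 : ℕ) * θ i.2)) S := by
  have hs : Summable fun j : ℕ+ => ((j : ℕ) : ℝ) ^ (-((d : ℝ) / δ)) * ‖((j : ℕ) : ℝ) * θ j‖ := by
    refine hT.congr fun j => ?_
    rw [Real.norm_of_nonneg (by positivity)]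
  have h := hasSum_offIndex hδ hδd hL (c := 1 / 2) (by norm_num) hs
  refine ⟨_, ?_, h⟩
  have hle : ∀ j : ℕ+, (∫ y, cellBoltzmann (d := d) δ L (1 / 2 * (j : ℕ)) y) • (((j : ℕ) : ℝ) * θ j)
      ≤ cellConst d δ * (1 / 2 : ℝ) ^ (-((d : ℝ) / δ)) *
        (((j : ℕ) : ℝ) ^ (-((d : ℝ) / δ)) * (((j : ℕ) : ℝ) * θ j)) := by
    intro j
    have hj := one_le_coe_pnat j
    have := integral_cellBoltzmann_le hδ hδd hL (β := 1 / 2 * ((j : ℕ) : ℝ)) (by positivity)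
    rw [Real.mul_rpow (by norm_num) (by positivity)] at this
    rw [smul_eq_mul]
    calc _ ≤ (cellConst d δ * ((1 / 2 : ℝ) ^ (-((d : ℝ) / δ)) * ((j : ℕ) : ℝ) ^ (-((d : ℝ) / δ)))) *
          (((j : ℕ) : ℝ) * θ j) := by gcongr
      _ = _ := by ring
  rw [smul_eq_mul, momentConst, ← tsum_mul_left (a := cellConst d δ * _)]
  refine mul_le_mul_of_nonneg_left (Summable.tsum_le_tsum hle ?_ (hT.mul_left _)) (by positivity)
  refine Summable.of_nonneg_of_le (fun j => ?_) hle (hT.mul_left _)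
  exact smul_nonneg (integral_cellBoltzmann_nonneg L _) (by positivity)

theorem summable_offWeight_mul_exp (hδ : 0 < δ) (hδd : δ < d) (hT : CritSummable d δ θ) {L : ℝ}
    (hL : 0 < L) {t : ℝ} (ht : t ≤ L ^ (-δ) / 2) :
    Summable fun i : OffIndex d => offWeight (trap d δ) θ L i * Real.exp (t * offSize i) := by
  obtain ⟨S, -, hS⟩ := hasSum_half hδ hδd hT hL
  refine Summable.of_nonneg_of_le
    (fun i => mul_nonneg (offWeight_nonneg _ _ _ i) (Real.exp_pos _).le)
    (fun i => (offWeight_mul_exp_le hδ hL ht i).trans ?_) hS.summable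
  gcongr
  have h := one_le_coe_pnat i.2
  rw [div_le_iff₀ (by positivity)]
  nlinarith [mul_le_mul h h zero_le_one (by positivity), (θ i.2).2]

/-- The logarithm of the moment generating function of M - E M is quadratic in `t` as far as the gap
allows: use `exp x - 1 - x ≤ x² exp |x|` and let half of the energy absorb the exponential. -/
theorem tsum_offWeight_mul_exp_sub_le (hδ : 0 < δ) (hδd : δ < d) (hT : CritSummable d δ θ) {L : ℝ}
    (hL : 0 < L) {t : ℝ} (ht : |t| ≤ L ^ (-δ) / 2) :
    ∑' i : OffIndex d, offWeight (trap d δ) θ L i *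
      (Real.exp (t * offSize i) - 1 - t * offSize i) ≤ t ^ 2 * (L ^ d * momentConst d δ θ) := by
  obtain ⟨S, hSle, hS⟩ := hasSum_half hδ hδd hT hL
  have hle : ∀ i : OffIndex d, offWeight (trap d δ) θ L i *
      (Real.exp (t * offSize i) - 1 - t * offSize i) ≤ t ^ 2 *
      (Real.exp (-((1 / 2 * (i.2 : ℕ)) * trap d δ (scaledSite L i.1))) * ((i.2 : ℕ) * θ i.2)) := by
    intro i
    have h1 := exp_sub_one_sub_le (t * offSize i)
    have h2 := offWeight_mul_exp_le (θ := θ) hδ hL ht i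
    have h3 : |t * (offSize i : ℝ)| = |t| * offSize i := by rw [abs_mul, Nat.abs_cast]
    rw [h3] at h1
    have hj := one_le_coe_pnat i.2
    calc _ ≤ offWeight (trap d δ) θ L i *
          ((t * offSize i) ^ 2 * Real.exp (|t| * offSize i)) := by
          gcongr
          exact offWeight_nonneg _ _ _ i
      _ = (t * offSize i) ^ 2 * (offWeight (trap d δ) θ L i * Real.exp (|t| * offSize i)) := by ring
      _ ≤ (t * offSize i) ^ 2 *
          (Real.exp (-((1 / 2 * (i.2 : ℕ)) * trap d δ (scaledSite L i.1))) *
            (θ i.2 / (i.2 : ℕ))) := by gcongr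
      _ = _ := by
          simp only [offSize]
          field_simp
  have hs : Summable fun i : OffIndex d => offWeight (trap d δ) θ L i *
      (Real.exp (t * offSize i) - 1 - t * offSize i) := by
    have h1 := summable_offWeight_mul_exp hδ hδd hT hL ((le_abs_self t).trans ht)
    have h2 := summable_offWeight hδ hδd hT hL
    have h3 := (hasSum_offWeight_mul_offSize hδ hδd hT hL).summable
    refine ((h1.sub h2).sub (h3.mul_left t)).congr fun i => ?_
    ring
  calc _ ≤ _ := hs.tsum_le_tsum hle (hS.mul_left _).summable
    _ = t ^ 2 * S := (hS.mul_left _).tsum_eq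
    _ ≤ _ := by gcongr

theorem tendsto_tsum_offWeight_cexp (hδ : 0 < δ) (hδd : δ < d) (hT : CritSummable d δ θ) (x : ℝ) :
    Tendsto (fun L : ℝ => ∑' i : OffIndex d, (offWeight (trap d δ) θ L i : ℂ) *
      (Complex.exp ((x / √(L ^ d) : ℝ) * Complex.I * offSize i) - 1 -
        (x / √(L ^ d) : ℝ) * Complex.I * offSize i)) atTop
      (𝓝 (-(x ^ 2 / 2 * ((∫ x : EuclideanSpace ℝ (Fin d), Real.exp (-trap d δ x)) *
        ∑' j : ℕ+, ((j : ℕ) : ℝ) ^ (-((d : ℝ) / δ)) * (((j : ℕ) : ℝ) * θ j)) : ℝ))) := by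
  have hd : d ≠ 0 := by
    have : 0 < d := by exact_mod_cast hδ.trans hδd
    omega
  -- The number `L ^ d` of sites per unit volume is moved into the summand, where it compensates the
  -- second-order smallness of the Taylor remainder.
  set f : ℝ → ℕ+ → ℂ := fun L j => ((L ^ d : ℝ) : ℂ) *
    (Complex.exp ((x * (j : ℕ) / √(L ^ d) : ℝ) * Complex.I) - 1 -
      (x * (j : ℕ) / √(L ^ d) : ℝ) * Complex.I) with hf
  have hbd : ∀ L j, 0 < L → ‖f L j‖ ≤ 3 * x ^ 2 * ((j : ℕ) : ℝ) ^ 2 := by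
    intro L j hL
    have hLd : 0 < L ^ d := by positivity
    have h1 := norm_cexp_I_mul_sub_le (x * (j : ℕ) / √(L ^ d))
    rw [div_pow, Real.sq_sqrt hLd.le] at h1
    simp only [hf]
    rw [norm_mul, Complex.norm_real, Real.norm_of_nonneg hLd.le]
    calc _ ≤ L ^ d * (3 * ((x * (j : ℕ)) ^ 2 / L ^ d)) := by gcongr
      _ = _ := by field_simp
  have hlim : ∀ j, Tendsto (fun L => f L j) atTop (𝓝 (-((x * (j : ℕ)) ^ 2 / 2 : ℝ))) := fun j =>
    (tendsto_mul_cexp_sub (x * (j : ℕ))).comp (tendsto_pow_atTop hd)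
  have h := tendsto_tsum_cellBoltzmann hδ hδd hT hbd hlim
  have hval : (∑' j : ℕ+, ((∫ x : EuclideanSpace ℝ (Fin d), Real.exp (-trap d δ x)) *
        ((j : ℕ) : ℝ) ^ (-((d : ℝ) / δ))) • (((θ j : ℝ) / ((j : ℕ) : ℝ)) •
          (-((x * (j : ℕ)) ^ 2 / 2 : ℝ) : ℂ))) =
      (-(x ^ 2 / 2 * ((∫ x : EuclideanSpace ℝ (Fin d), Real.exp (-trap d δ x)) *
        ∑' j : ℕ+, ((j : ℕ) : ℝ) ^ (-((d : ℝ) / δ)) * (((j : ℕ) : ℝ) * θ j)) : ℝ)) := by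
    rw [← tsum_mul_left, ← tsum_mul_left, ← Complex.ofReal_neg, ← tsum_neg, Complex.ofReal_tsum]
    refine tsum_congr fun j => ?_
    have hj := one_le_coe_pnat j
    rw [Complex.real_smul, Complex.real_smul, ← Complex.ofReal_neg, ← Complex.ofReal_mul,
      ← Complex.ofReal_mul]
    congr 1
    field_simp
  rw [hval] at h
  refine h.congr' ?_
  filter_upwards [eventually_gt_atTop 0] with L hL
  have hLd : (L ^ d : ℝ) ≠ 0 := by positivity
  have hLd' : ((L ^ d : ℝ) : ℂ) ≠ 0 := by exact_mod_cast hLd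
  have hsum := (hasSum_offWeight_smul hδ hδd hT hL (f := fun j => ((L ^ d : ℝ) : ℂ)⁻¹ * f L j)
    (K := (L ^ d)⁻¹ * (3 * x ^ 2)) fun j => by
      rw [norm_mul, norm_inv, Complex.norm_real, Real.norm_of_nonneg (by positivity : 0 ≤ L ^ d),
        mul_assoc]
      gcongr
      exact hbd L j hL).tsum_eq
  have hl : (∑' i : OffIndex d, offWeight (trap d δ) θ L i • (((L ^ d : ℝ) : ℂ)⁻¹ * f L i.2)) =
      ∑' i : OffIndex d, (offWeight (trap d δ) θ L i : ℂ) *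
      (Complex.exp ((x / √(L ^ d) : ℝ) * Complex.I * offSize i) - 1 -
        (x / √(L ^ d) : ℝ) * Complex.I * offSize i) := by
    refine tsum_congr fun i => ?_
    rw [Complex.real_smul]
    simp only [hf, offSize]
    rw [inv_mul_cancel_left₀ hLd']
    have : ((x * (i.2 : ℕ) / √(L ^ d) : ℝ) : ℂ) * Complex.I =
        ((x / √(L ^ d) : ℝ) : ℂ) * Complex.I * ((i.2 : ℕ) : ℂ) := by push_cast; ring
    rw [this]
  rw [← hl, hsum, ← tsum_const_smul'']
  refine tsum_congr fun j => ?_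
  simp only [Complex.real_smul]
  field_simp

end

end SpatialPartitions

/-! ### The critical fugacity, density and variance. -/

namespace SpatialPartitions

section

variable {d : ℕ} {δ : ℝ} {θ : ℕ → ℝ≥0}

theorem critSummable_of_summable
    (hθ : Summable fun j : ℕ => (j : ℝ) * (θ j : ℝ) / (j : ℝ) ^ ((d : ℝ) / δ)) :
    CritSummable d δ θ := by
  refine (hθ.comp_injective PNat.coe_injective).congr fun j => ?_
  simp only [Function.comp]
  rw [Real.rpow_neg (Nat.cast_nonneg _)]
  field_simp

/-- `∫ e^{-V}` for the trap potential `V`. -/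
noncomputable def trapIntegral (d : ℕ) (δ : ℝ) : ℝ :=
  ∫ x : EuclideanSpace ℝ (Fin d), Real.exp (-trap d δ x)

theorem boltzmannIntegral_eq_trapIntegral (hδ : 0 < δ) (hδd : δ < d) (j : ℕ+) :
    boltzmannIntegral (trap d δ) j =
      ENNReal.ofReal (trapIntegral d δ * ((j : ℕ) : ℝ) ^ (-((d : ℝ) / δ))) :=
  boltzmannIntegral_eq hδ hδd j

theorem CritSummable.density_term_summable (hT : CritSummable d δ θ) :
    Summable fun j : ℕ+ => (trapIntegral d δ * ((j : ℕ) : ℝ) ^ (-((d : ℝ) / δ))) * θ j := by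
  refine Summable.of_nonneg_of_le (fun j => ?_) (fun j => ?_) (hT.mul_left (trapIntegral d δ))
  · have : 0 ≤ trapIntegral d δ := integral_nonneg fun _ => (Real.exp_pos _).le
    positivity
  · have : 0 ≤ trapIntegral d δ := integral_nonneg fun _ => (Real.exp_pos _).le
    rw [mul_assoc]
    gcongr
    exact le_mul_of_one_le_left (NNReal.coe_nonneg _) (one_le_coe_pnat j)

theorem density_one (hδ : 0 < δ) (hδd : δ < d) (hT : CritSummable d δ θ) :
    density (trap d δ) θ 1 = ENNReal.ofReal
      (∑' j : ℕ+, (trapIntegral d δ * ((j : ℕ) : ℝ) ^ (-((d : ℝ) / δ))) * θ j) := by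
  have h0 : 0 ≤ trapIntegral d δ := integral_nonneg fun _ => (Real.exp_pos _).le
  rw [ENNReal.ofReal_tsum_of_nonneg (fun j => by positivity) hT.density_term_summable, density]
  refine tsum_congr fun j => ?_
  rw [one_pow, mul_one, boltzmannIntegral_eq_trapIntegral hδ hδd, mul_comm,
    ENNReal.ofReal_mul (q := (θ j : ℝ)) (by positivity), ENNReal.ofReal_coe_nnreal]

theorem critVariance_eq (hδ : 0 < δ) (hδd : δ < d) (hT : CritSummable d δ θ) :
    critVariance (trap d δ) θ = ENNReal.ofReal (trapIntegral d δ *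
      ∑' j : ℕ+, ((j : ℕ) : ℝ) ^ (-((d : ℝ) / δ)) * (((j : ℕ) : ℝ) * θ j)) := by
  have h0 : 0 ≤ trapIntegral d δ := integral_nonneg fun _ => (Real.exp_pos _).le
  rw [← tsum_mul_left, ENNReal.ofReal_tsum_of_nonneg (fun j => by positivity) (hT.mul_left _),
    critVariance]
  refine tsum_congr fun j => ?_
  rw [boltzmannIntegral_eq_trapIntegral hδ hδd, mul_comm, ← mul_assoc (trapIntegral d δ),
    ENNReal.ofReal_mul (q := ((j : ℕ) : ℝ) * θ j) (by positivity),
    ENNReal.ofReal_mul (q := (θ j : ℝ)) (by positivity), ENNReal.ofReal_coe_nnreal, ENNReal.ofReal_natCast]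

theorem h_eq_occCoeff (hs : Summable fun j : ℕ+ => ((θ j / ((j : ℕ) : ℝ≥0) : ℝ≥0) : ℝ)) (k : ℕ) :
    h θ k = occCoeff (fun j : ℕ+ => ((θ j / ((j : ℕ) : ℝ≥0) : ℝ≥0) : ℝ))
      (fun j : ℕ+ => (j : ℕ)) k := by
  have h1 := h_eq_tsum θ k
  rw [← ofReal_occCoeff hs, ENNReal.ofReal_eq_ofReal_iff (h_nonneg θ k)
    (occCoeff_nonneg (fun _ => NNReal.coe_nonneg _) _ _)] at h1
  exact h1

/-- The exponential formula at the origin: the generating function of h is `exp (∑ θ_j / j * z ^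
j)`, so it converges wherever `∑ θ_j * z ^ j` does. -/
theorem summable_h_mul_exp {t : ℝ} (ht : 0 ≤ t)
    (hs : Summable fun j : ℕ+ => (θ j : ℝ) * Real.exp (t * ((j : ℕ) : ℝ))) :
    Summable fun k : ℕ => h θ k * Real.exp (t * k) := by
  have h1 : Summable fun j : ℕ+ =>
      ((θ j / ((j : ℕ) : ℝ≥0) : ℝ≥0) : ℝ) * Real.exp (t * ((j : ℕ) : ℝ)) := by
    refine Summable.of_nonneg_of_le (fun j => by positivity) (fun j => ?_) hs
    gcongr
    rw [← NNReal.coe_le_coe, NNReal.coe_div, NNReal.coe_natCast]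
    exact div_le_self (NNReal.coe_nonneg _) (one_le_coe_pnat j)
  have h2 : Summable fun j : ℕ+ => ((θ j / ((j : ℕ) : ℝ≥0) : ℝ≥0) : ℝ) := by
    refine Summable.of_nonneg_of_le (fun j => NNReal.coe_nonneg _) (fun j => ?_) h1
    exact le_mul_of_one_le_right (NNReal.coe_nonneg _) (Real.one_le_exp (by positivity))
  have h3 := hasSum_occCoeff (w := fun j : ℕ+ => ((θ j / ((j : ℕ) : ℝ≥0) : ℝ≥0) : ℝ))
    (fun j : ℕ+ => (j : ℕ)) (t : ℂ) (h1.congr fun j => by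
      rw [norm_mul, Complex.norm_of_nonneg (NNReal.coe_nonneg _), Complex.norm_exp]
      simp)
  refine Complex.summable_ofReal.1 (h3.summable.congr fun k => ?_)
  rw [← h_eq_occCoeff h2]
  push_cast
  rfl

theorem tendsto_mul_sub_mul_rpow {A B p q : ℝ} (hA : 0 < A) (hp : 0 ≤ p) (hpq : p < q) :
    Tendsto (fun n : ℕ => A * (n : ℝ) ^ q - B * (n : ℝ) ^ p) atTop atTop := by
  have h1 : Tendsto (fun n : ℕ => (n : ℝ) ^ (q - p)) atTop atTop :=
    (tendsto_rpow_atTop (sub_pos.2 hpq)).comp tendsto_natCast_atTop_atTop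
  have h2 : Tendsto (fun n : ℕ => A * (n : ℝ) ^ (q - p) - B) atTop atTop :=
    tendsto_atTop_add_const_right _ _ (h1.const_mul_atTop hA)
  refine tendsto_atTop_mono' _ ?_ h2
  filter_upwards [eventually_ge_atTop 1, h2.eventually_ge_atTop 0] with n hn hn2
  have hn' : (1 : ℝ) ≤ n := by exact_mod_cast hn
  have h3 : (n : ℝ) ^ q = (n : ℝ) ^ (q - p) * (n : ℝ) ^ p := by
    rw [← Real.rpow_add (by linarith), sub_add_cancel]
  rw [h3, ← mul_assoc, ← sub_mul]
  exact le_mul_of_one_le_right hn2 (Real.one_le_rpow hn' hp)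

/-- Since `a < 1`, the factor `exp (t n)` beats `exp (-c n^a)` and the terms do not tend to 0. -/
theorem not_summable_h_mul_exp {C c a t : ℝ} (hC : 0 < C) (ha0 : 0 ≤ a) (ha1 : a < 1)
    (hlow : ∀ n : ℕ, 1 ≤ n → C⁻¹ * Real.exp (-(c * (n : ℝ) ^ a)) ≤ h θ n) (ht : 0 < t) :
    ¬ Summable fun k : ℕ => h θ k * Real.exp (t * k) := by
  intro hs
  have h1 := hs.tendsto_atTop_zero.eventually_lt_const (inv_pos.2 hC)
  have h2 := (tendsto_mul_sub_mul_rpow (B := c) ht ha0 ha1).eventually_ge_atTop 0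
  obtain ⟨n, hn1, hn2, hn3⟩ := (h1.and (h2.and (eventually_ge_atTop 1))).exists
  have h3 : C⁻¹ * 1 ≤ C⁻¹ * Real.exp (-(c * (n : ℝ) ^ a)) * Real.exp (t * n) := by
    rw [mul_assoc, ← Real.exp_add]
    gcongr
    refine Real.one_le_exp ?_
    rw [Real.rpow_one] at hn2
    linarith
  have h4 := mul_le_mul_of_nonneg_right (hlow n hn3) (Real.exp_pos (t * n)).le
  linarith

theorem summable_mul_exp_of_density_ne_top (hδ : 0 < δ) (hδd : δ < d) {z : ℝ≥0∞} (hz : 1 < z)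
    (h : density (trap d δ) θ z ≠ ∞) :
    ∃ t : ℝ, 0 < t ∧ Summable fun j : ℕ+ => (θ j : ℝ) * Real.exp (t * ((j : ℕ) : ℝ)) := by
  obtain ⟨y, hy1, hyz⟩ := ENNReal.lt_iff_exists_nnreal_btwn.1 hz
  have hy : (1 : ℝ) < y := by exact_mod_cast hy1
  have hK : 0 < trapIntegral d δ := integral_exp_trap_pos hδ hδd
  have hsum : Summable fun j : ℕ+ => (θ j : ℝ) * (y : ℝ) ^ (j : ℕ) *
      (trapIntegral d δ * ((j : ℕ) : ℝ) ^ (-((d : ℝ) / δ))) := by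
    have hfin : density (trap d δ) θ y ≠ ∞ := by
      refine ne_top_of_le_ne_top h (ENNReal.tsum_le_tsum fun j => ?_)
      gcongr
    refine (ENNReal.summable_toReal hfin).congr fun j => ?_
    rw [boltzmannIntegral_eq_trapIntegral hδ hδd, ENNReal.toReal_mul, ENNReal.toReal_mul, ENNReal.toReal_pow,
      ENNReal.toReal_ofReal (mul_nonneg hK.le (by positivity))]
    rfl
  have hlog := Real.log_pos hy
  -- One half of the exponential rate `log y` is kept; the other pays for the factor `j ^ (d/δ)`
  -- lost when the Boltzmann integrals are removed.
  refine ⟨Real.log y / 2, by positivity, ?_⟩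
  obtain ⟨k, hk⟩ := exists_nat_ge ((d : ℝ) / δ)
  have hr0 : 0 < Real.exp (-(Real.log y / 2)) := Real.exp_pos _
  have hr : |Real.exp (-(Real.log y / 2))| < 1 := by
    rw [abs_of_pos hr0, Real.exp_lt_one_iff]
    linarith
  obtain ⟨M, hM⟩ := (tendsto_pow_const_mul_const_pow_of_abs_lt_one k hr).bddAbove_range
  refine Summable.of_nonneg_of_le (fun j => by positivity) (fun j => ?_)
    (hsum.mul_left (M / trapIntegral d δ))
  have hj := one_le_coe_pnat j
  have h1 : ((j : ℕ) : ℝ) ^ k * Real.exp (-(Real.log y / 2)) ^ (j : ℕ) ≤ M :=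
    hM ⟨(j : ℕ), rfl⟩
  have h2 : ((j : ℕ) : ℝ) ^ ((d : ℝ) / δ) ≤ ((j : ℕ) : ℝ) ^ k := by
    rw [← Real.rpow_natCast]
    exact Real.rpow_le_rpow_of_exponent_le hj hk
  have h3 : Real.exp (Real.log y / 2 * ((j : ℕ) : ℝ)) =
      (y : ℝ) ^ (j : ℕ) * Real.exp (-(Real.log y / 2)) ^ (j : ℕ) := by
    have h5 : (y : ℝ) * Real.exp (-(Real.log y / 2)) = Real.exp (Real.log y / 2) := by
      calc _ = Real.exp (Real.log y) * Real.exp (-(Real.log y / 2)) := by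
            rw [Real.exp_log (zero_lt_one.trans hy)]
        _ = _ := by rw [← Real.exp_add]; ring_nf
    rw [← mul_pow, h5, ← Real.exp_nat_mul, mul_comm]
  have h4 : Real.exp (-(Real.log y / 2)) ^ (j : ℕ) ≤ M * ((j : ℕ) : ℝ) ^ (-((d : ℝ) / δ)) := by
    rw [Real.rpow_neg (by positivity), ← div_eq_mul_inv, le_div_iff₀ (by positivity), mul_comm]
    exact (mul_le_mul_of_nonneg_right h2 (by positivity)).trans h1
  rw [h3]
  calc (θ j : ℝ) * ((y : ℝ) ^ (j : ℕ) * Real.exp (-(Real.log y / 2)) ^ (j : ℕ))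
      ≤ (θ j : ℝ) * ((y : ℝ) ^ (j : ℕ) * (M * ((j : ℕ) : ℝ) ^ (-((d : ℝ) / δ)))) := by gcongr
    _ = _ := by field_simp

theorem critFugacity_eq_one (hδ : 0 < δ) (hδd : δ < d) (hT : CritSummable d δ θ)
    {C c a : ℝ} (hC : 0 < C) (ha0 : 0 ≤ a) (ha1 : a < 1)
    (hlow : ∀ n : ℕ, 1 ≤ n → C⁻¹ * Real.exp (-(c * (n : ℝ) ^ a)) ≤ h θ n) :
    critFugacity (trap d δ) θ = 1 := by
  refine le_antisymm (sSup_le fun z hz => ?_) (le_sSup ?_)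
  · by_contra! hz1
    obtain ⟨t, ht, hs⟩ := summable_mul_exp_of_density_ne_top hδ hδd hz1 hz
    exact not_summable_h_mul_exp hC ha0 ha1 hlow ht (summable_h_mul_exp ht.le hs)
  · exact (density_one hδ hδd hT).trans_ne ENNReal.ofReal_ne_top

theorem lintegral_natCast_poissonMeasure (r : ℝ≥0) :
    ∫⁻ k : ℕ, (k : ℝ≥0∞) ∂(poissonMeasure r) = r := by
  have h1 : HasSum (fun k : ℕ => (k : ℝ) * (Real.exp (-r) * r ^ k / k !)) r := by
    rw [← hasSum_nat_add_iff' 1]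
    have := (hasSum_one_poissonMeasure r).mul_left (r : ℝ)
    convert! this using 1
    · funext k
      rw [Nat.factorial_succ]
      push_cast
      field_simp
      ring
    · simp
  rw [lintegral_countable']
  simp_rw [poissonMeasure_singleton]
  have h2 : ∀ k : ℕ, (k : ℝ≥0∞) * ENNReal.ofReal (Real.exp (-r) * r ^ k / k !) =
      ENNReal.ofReal ((k : ℝ) * (Real.exp (-r) * r ^ k / k !)) := fun k => by
    rw [ENNReal.ofReal_mul (Nat.cast_nonneg k), ENNReal.ofReal_natCast]
  simp_rw [h2]
  rw [← ENNReal.ofReal_tsum_of_nonneg (fun k => by positivity) h1.summable, h1.tsum_eq,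
    ENNReal.ofReal_coe_nnreal]

/-- By linearity only the Poisson means enter, so independence plays no role. -/
theorem lintegral_offOrigin (V : EuclideanSpace ℝ (Fin d) → ℝ) (θ : ℕ → ℝ≥0) (L : ℝ) :
    ∫⁻ R, offOrigin R ∂(grandCanonical V θ L 1) =
      ∑' i : OffIndex d, ((offSize i : ℝ≥0∞) * (siteWeight V θ L i.1 i.2 : ℝ≥0∞)) := by
  have h1 : ∀ R : Site d × ℕ+ → ℕ, offOrigin R =
      ∑' i : OffIndex d, (offSize i : ℝ≥0∞) * (R (i.1, i.2) : ℝ≥0∞) := fun R =>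
    (ENNReal.tsum_prod (f := fun (x : {x : Site d // x ≠ 0}) (j : ℕ+) =>
      ((j : ℕ) : ℝ≥0∞) * (R (x, j) : ℝ≥0∞))).symm
  have hm : ∀ p : Site d × ℕ+, Measurable fun R : Site d × ℕ+ → ℕ => (R p : ℝ≥0∞) := fun p =>
    (measurable_of_countable (fun k : ℕ => (k : ℝ≥0∞))).comp (measurable_pi_apply p)
  simp_rw [h1]
  rw [lintegral_tsum fun i => ((hm _).const_mul _).aemeasurable]
  refine tsum_congr fun i => ?_
  rw [lintegral_const_mul _ (hm _)]
  congr 1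
  have hp := measurePreserving_eval_infinitePi (fun p : Site d × ℕ+ =>
    poissonMeasure ((1 : ℝ≥0) ^ (p.2 : ℕ) * siteWeight V θ L p.1 p.2)) (i.1.1, i.2)
  have h2 := hp.lintegral_comp (measurable_of_countable (fun k : ℕ => (k : ℝ≥0∞)))
  rw [lintegral_natCast_poissonMeasure] at h2
  rw [one_pow, one_mul] at h2
  exact h2

/-- Identifies the centring: L^d (ρ - ρ_c^L) is `n` minus the mean of M when n = ρ L^d. -/
theorem pow_mul_critDensityAt (hδ : 0 < δ) (hδd : δ < d) (hT : CritSummable d δ θ)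
    (hcrit : critFugacity (trap d δ) θ = 1) {L : ℝ} (hL : 0 < L) :
    L ^ d * critDensityAt (trap d δ) θ L = offMean d δ θ L := by
  have h1 := (hasSum_offWeight_mul_offSize hδ hδd hT hL).summable
  rw [critDensityAt, hcrit, ENNReal.toNNReal_one, lintegral_offOrigin, mul_div_cancel₀]
  · have h2 : ∀ i : OffIndex d, (offSize i : ℝ≥0∞) * (siteWeight (trap d δ) θ L i.1 i.2 : ℝ≥0∞) =
        ENNReal.ofReal (offWeight (trap d δ) θ L i * offSize i) := fun i => by
      rw [mul_comm, ENNReal.ofReal_mul (offWeight_nonneg _ _ _ i), ENNReal.ofReal_natCast,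
        offWeight, ENNReal.ofReal_coe_nnreal]
    have h3 : ∀ i : OffIndex d, 0 ≤ offWeight (trap d δ) θ L i * offSize i := fun i =>
      mul_nonneg (offWeight_nonneg _ _ _ i) (Nat.cast_nonneg _)
    simp_rw [h2]
    rw [← ENNReal.ofReal_tsum_of_nonneg h3 h1, ENNReal.toReal_ofReal (tsum_nonneg h3)]
    rfl
  · positivity

end

end SpatialPartitions

/-! ### Flatness of h, and comparison of a law with its tilt. -/

namespace SpatialPartitions

theorem hInt_nonneg (θ : ℕ → ℝ≥0) (m : ℤ) : 0 ≤ hInt θ m := by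
  unfold hInt
  split_ifs
  exacts [h_nonneg θ _, le_rfl]

theorem hInt_natCast (θ : ℕ → ℝ≥0) (m : ℕ) : hInt θ m = h θ m := by simp [hInt]

theorem le_maxRatio (θ : ℕ → ℝ≥0) {b : ℝ} {n : ℕ} {k : ℤ} (hk : |(k : ℝ)| ≤ (n : ℝ) ^ b) :
    hInt θ ((n : ℤ) + k) / h θ n ≤ maxRatio θ b n := by
  have : Finite {m : ℤ // |(m : ℝ)| ≤ (n : ℝ) ^ b} := by
    refine ((Set.finite_Icc (-⌈(n : ℝ) ^ b⌉) ⌈(n : ℝ) ^ b⌉).subset fun m hm => ?_).to_subtype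
    have h1 : |(m : ℝ)| ≤ (⌈(n : ℝ) ^ b⌉ : ℝ) := le_trans hm (Int.le_ceil _)
    have h2 : |m| ≤ ⌈(n : ℝ) ^ b⌉ := by exact_mod_cast h1
    exact abs_le.1 h2
  exact le_ciSup (f := fun m : {m : ℤ // |(m : ℝ)| ≤ (n : ℝ) ^ b} =>
    hInt θ ((n : ℤ) + m) / h θ n) (Set.finite_range _).bddAbove ⟨k, hk⟩

/-- For `n ≥ 1` the maximum is at least 1, by the zero shift, and grows with the window. This allows
`b ≤ 1` to be assumed. -/
theorem tendsto_maxRatio_of_le {θ : ℕ → ℝ≥0} (hpos : ∀ n : ℕ, 1 ≤ n → 0 < h θ n) {b b' : ℝ}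
    (hb : b' ≤ b) (hflat : Tendsto (maxRatio θ b) atTop (𝓝 1)) :
    Tendsto (maxRatio θ b') atTop (𝓝 1) := by
  refine tendsto_of_tendsto_of_tendsto_of_le_of_le' tendsto_const_nhds hflat ?_ ?_
  · filter_upwards [eventually_ge_atTop 1] with n hn
    have h1 := le_maxRatio θ (b := b') (n := n) (k := 0) (by simp; positivity)
    rwa [add_zero, hInt_natCast, div_self (hpos n hn).ne'] at h1
  · filter_upwards [eventually_ge_atTop 1] with n hn
    have : Nonempty {m : ℤ // |(m : ℝ)| ≤ (n : ℝ) ^ b'} := ⟨0, by simp; positivity⟩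
    exact ciSup_le fun m => le_maxRatio θ
      (m.2.trans (Real.rpow_le_rpow_of_exponent_le (by exact_mod_cast hn) hb))

/-- `maxRatio` bounds ratios only from above. The lower bound comes from applying it at `N + k` with
the shift `-k`, which is admissible for half the window, since `N + k ≥ N / 2` and `b ≤ 1` give `(N
+ k) ^ b ≥ N ^ b / 2`. -/
theorem eventually_abs_hInt_div_sub_one_le {θ : ℕ → ℝ≥0} (hpos : ∀ n : ℕ, 1 ≤ n → 0 < h θ n)
    {b : ℝ} (hb0 : 0 ≤ b) (hb1 : b ≤ 1) (hflat : Tendsto (maxRatio θ b) atTop (𝓝 1))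
    {ε : ℝ} (hε : 0 < ε) :
    ∀ᶠ N : ℕ in atTop, ∀ k : ℤ, |(k : ℝ)| ≤ (N : ℝ) ^ b / 2 →
      |hInt θ ((N : ℤ) + k) / h θ N - 1| ≤ ε := by
  obtain ⟨N₀, hN₀⟩ := eventually_atTop.1
    (hflat.eventually_le_const (show (1 : ℝ) < 1 + ε by linarith))
  -- With this bound both `N` and `N + k ≥ N / 2` are past the threshold `N₀` and at least 1.
  filter_upwards [eventually_ge_atTop (2 * N₀ + 2)] with N hN k hk
  have hN1 : (1 : ℝ) ≤ N := by exact_mod_cast (by omega : 1 ≤ N)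
  have hNb : (N : ℝ) ^ b ≤ N := by
    simpa using Real.rpow_le_rpow_of_exponent_le hN1 hb1
  have hNb0 : 0 ≤ (N : ℝ) ^ b := by positivity
  have hk1 := abs_le.1 hk
  obtain ⟨M, hM⟩ : ∃ M : ℕ, (M : ℤ) = N + k := by
    refine ⟨((N : ℤ) + k).toNat, Int.toNat_of_nonneg ?_⟩
    have : (0 : ℝ) ≤ ((N + k : ℤ) : ℝ) := by push_cast; linarith
    exact_mod_cast this
  have hMr : (M : ℝ) = N + k := by exact_mod_cast congrArg (Int.cast : ℤ → ℝ) hM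
  have hM2 : (N : ℝ) / 2 ≤ M := by linarith
  have hM3 : N₀ + 1 ≤ M := by
    have h1 : ((N₀ + 1 : ℕ) : ℝ) ≤ M := by
      have h2 : ((2 * N₀ + 2 : ℕ) : ℝ) ≤ N := by exact_mod_cast hN
      push_cast at h2 ⊢
      linarith
    exact_mod_cast h1
  have hpN := hpos N (by omega)
  have hpM := hpos M (by omega)
  have hup : hInt θ ((N : ℤ) + k) / h θ N ≤ 1 + ε :=
    (le_maxRatio θ (by linarith)).trans (hN₀ N (by omega))
  have hMb : (N : ℝ) ^ b / 2 ≤ (M : ℝ) ^ b := by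
    calc (N : ℝ) ^ b / 2 = (N : ℝ) ^ b * (1 / 2 : ℝ) ^ (1 : ℝ) := by rw [Real.rpow_one]; ring
      _ ≤ (N : ℝ) ^ b * (1 / 2 : ℝ) ^ b := by
          gcongr ?_ * ?_
          exact Real.rpow_le_rpow_of_exponent_ge (by norm_num) (by norm_num) hb1
      _ = ((N : ℝ) / 2) ^ b := by rw [← Real.mul_rpow (by positivity) (by norm_num)]; ring_nf
      _ ≤ (M : ℝ) ^ b := Real.rpow_le_rpow (by positivity) hM2 hb0
  have hlo : h θ N / h θ M ≤ 1 + ε := by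
    have h1 := (le_maxRatio θ (b := b) (n := M) (k := -k) (by
      push_cast; rw [abs_neg]; linarith)).trans (hN₀ M (by omega))
    rwa [hM, add_neg_cancel_right, hInt_natCast] at h1
  rw [← hM, hInt_natCast] at hup ⊢
  rw [abs_le]
  refine ⟨?_, by linarith⟩
  rw [div_le_iff₀ hpM] at hlo
  -- This is `(1 - ε) * (1 + ε) ≤ 1`; if `ε > 1` the left side is negative.
  have h2 : 1 - ε ≤ h θ M / h θ N := by
    rw [le_div_iff₀ hpN]
    rcases le_or_gt ε 1 with h3 | h3
    · nlinarith [mul_le_mul_of_nonneg_left hlo (sub_nonneg.2 h3), sq_nonneg ε]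
    · nlinarith
  linarith

/-- Expectations under two laws with asymptotically equal densities have the same limit. -/
theorem tendsto_tilted {p g : ℕ → ℕ → ℝ} {f : ℕ → ℕ → ℂ} {y : ℂ}
    (hp : ∀ᶠ n in atTop, (∀ m, 0 ≤ p n m) ∧ HasSum (p n) 1)
    (hs : ∀ᶠ n in atTop, Summable fun m => p n m * |g n m - 1|)
    (hD : Tendsto (fun n => ∑' m, p n m * |g n m - 1|) atTop (𝓝 0))
    (hf : ∀ n m, ‖f n m‖ ≤ 1)
    (hy : Tendsto (fun n => ∑' m, (p n m : ℂ) * f n m) atTop (𝓝 y)) :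
    Tendsto (fun n => (∑' m, ((p n m * g n m : ℝ) : ℂ) * f n m) /
      ((∑' m, p n m * g n m : ℝ) : ℂ)) atTop (𝓝 y) := by
  -- The total variation bound is stated for every bounded `f`, because `f = 1` also gives the
  -- convergence of the normalization to 1.
  have key : ∀ f : ℕ → ℕ → ℂ, (∀ n m, ‖f n m‖ ≤ 1) →
      Tendsto (fun n => (∑' m, ((p n m * g n m : ℝ) : ℂ) * f n m) - ∑' m, (p n m : ℂ) * f n m)
        atTop (𝓝 0) := by
    intro f hf
    refine squeeze_zero_norm' ?_ hD
    filter_upwards [hp, hs] with n hn hsn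
    have hb : ∀ m, ‖(p n m : ℂ) * ((g n m : ℂ) - 1) * f n m‖ ≤ p n m * |g n m - 1| := fun m => by
      rw [norm_mul, norm_mul, Complex.norm_of_nonneg (hn.1 m)]
      have : ‖(g n m : ℂ) - 1‖ = |g n m - 1| := by
        rw [← Real.norm_eq_abs, ← Complex.norm_real]
        push_cast
        rfl
      rw [this]
      exact mul_le_of_le_one_right (mul_nonneg (hn.1 m) (abs_nonneg _)) (hf n m)
    have h1 : Summable fun m => (p n m : ℂ) * ((g n m : ℂ) - 1) * f n m :=
      Summable.of_norm_bounded hsn hb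
    have h2 : Summable fun m => (p n m : ℂ) * f n m :=
      Summable.of_norm_bounded hn.2.summable fun m => by
        rw [norm_mul, Complex.norm_of_nonneg (hn.1 m)]
        exact mul_le_of_le_one_right (hn.1 m) (hf n m)
    have h3 : (∑' m, ((p n m * g n m : ℝ) : ℂ) * f n m) - ∑' m, (p n m : ℂ) * f n m =
        ∑' m, (p n m : ℂ) * ((g n m : ℂ) - 1) * f n m := by
      rw [sub_eq_iff_eq_add, ← h1.tsum_add h2]
      refine tsum_congr fun m => ?_
      push_cast
      ring
    rw [h3]
    exact tsum_of_norm_bounded hsn.hasSum hb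
  have hden : Tendsto (fun n => ((∑' m, p n m * g n m : ℝ) : ℂ)) atTop (𝓝 1) := by
    have h1 := key (fun _ _ => 1) (fun _ _ => by simp)
    have h2 : (fun n => (∑' m, ((p n m * g n m : ℝ) : ℂ) * 1) - ∑' m, (p n m : ℂ) * 1) =ᶠ[atTop]
        fun n => ((∑' m, p n m * g n m : ℝ) : ℂ) - 1 := by
      filter_upwards [hp] with n hn
      simp_rw [mul_one]
      rw [← Complex.ofReal_tsum, ← Complex.ofReal_tsum, hn.2.tsum_eq, Complex.ofReal_one]
    simpa using (h1.congr' h2).add_const 1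
  have hnum : Tendsto (fun n => ∑' m, ((p n m * g n m : ℝ) : ℂ) * f n m) atTop (𝓝 y) := by
    simpa using (key f hf).add hy
  have h := hnum.div hden one_ne_zero
  rw [div_one] at h
  exact h

/-! ### The law of H_0 as a tilted compound Poisson law. -/

section

variable {d : ℕ} {δ : ℝ} {θ : ℕ → ℝ≥0}

/-- The weight of the spatial partitions of `n` with `k` particles at the origin. -/
noncomputable def originMass (d : ℕ) (δ : ℝ) (θ : ℕ → ℝ≥0) (L : ℝ) (n k : ℕ) : ℝ :=
  h θ k * occCoeff (offWeight (trap d δ) θ L) offSize (n - k)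

theorem originMass_nonneg (L : ℝ) (n k : ℕ) : 0 ≤ originMass d δ θ L n k :=
  mul_nonneg (h_nonneg θ k) (occCoeff_nonneg (offWeight_nonneg _ _ _) _ _)

theorem one_le_occCoeff_zero {I : Type*} {w : I → ℝ} (h0 : ∀ i, 0 ≤ w i) (hw : Summable w)
    (s : I → ℕ) : 1 ≤ occCoeff w s 0 := by
  have hsub : Summable fun r : {r : I →₀ ℕ // occSize s r = 0} => occWeight w r.1 :=
    (summable_occWeight_real h0 hw).comp_injective Subtype.val_injective
  have := hsub.le_tsum ⟨0, by simp [occSize]⟩ fun r _ => occWeight_nonneg h0 r.1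
  have h1 : occWeight w 0 = 1 := Finsupp.prod_zero_index
  exact h1.ge.trans this

/-- The configurations with all particles at the origin already have positive weight. -/
theorem sum_originMass_pos {L : ℝ} (hs : Summable (offWeight (trap d δ) θ L)) {n : ℕ}
    (hn : 0 < h θ n) : 0 < ∑ k ∈ Finset.range (n + 1), originMass d δ θ L n k := by
  refine Finset.sum_pos' (fun k _ => originMass_nonneg L n k) ⟨n, by simp, ?_⟩
  rw [originMass, Nat.sub_self]
  exact mul_pos hn (zero_lt_one.trans_le (one_le_occCoeff_zero (offWeight_nonneg _ _ _) hs _))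

theorem partitionFunction_eq (hδ : 0 < δ) {L : ℝ} (hs : Summable (offWeight (trap d δ) θ L))
    (n : ℕ) : partitionFunction (trap d δ) θ L n =
      ENNReal.ofReal (∑ k ∈ Finset.range (n + 1), originMass d δ θ L n k) := by
  have := tsum_weight_mul hδ hs n fun _ => 1
  simp_rw [mul_one] at this
  rw [ENNReal.ofReal_sum_of_nonneg fun k _ => originMass_nonneg L n k]
  exact this

theorem canonicalMeasure_apply (V : EuclideanSpace ℝ (Fin d) → ℝ) (θ : ℕ → ℝ≥0) (L : ℝ) (n : ℕ)
    (S : Set (SpatialPartition d n)) :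
    canonicalMeasure V θ L n S = (partitionFunction V θ L n)⁻¹ *
      ∑' l, (weight V θ L l : ℝ≥0∞) * S.indicator 1 l := by
  rw [canonicalMeasure, Measure.smul_apply, Measure.sum_apply _ MeasurableSpace.measurableSet_top, smul_eq_mul]
  congr 1
  refine tsum_congr fun l => ?_
  rw [Measure.smul_apply, Measure.dirac_apply' _ MeasurableSpace.measurableSet_top, smul_eq_mul]

theorem isProbabilityMeasure_canonicalMeasure {V : EuclideanSpace ℝ (Fin d) → ℝ} {L : ℝ} {n : ℕ}
    (h0 : partitionFunction V θ L n ≠ 0) (h1 : partitionFunction V θ L n ≠ ∞) :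
    IsProbabilityMeasure (canonicalMeasure V θ L n) := by
  constructor
  rw [canonicalMeasure_apply]
  simp only [Set.indicator_univ, Pi.one_apply, mul_one]
  exact ENNReal.inv_mul_cancel h0 h1

/-- Treated apart because n = 0 forces L = 0 in the theorem, where the estimates for L > 0 are not
available. -/
theorem partitionFunction_zero (V : EuclideanSpace ℝ (Fin d) → ℝ) (θ : ℕ → ℝ≥0) (L : ℝ) :
    partitionFunction V θ L 0 = 1 := by
  have hl : ∀ l : SpatialPartition d 0, l.lam = 0 := by
    intro l
    ext1 x
    by_contra hx
    have h1 := (Finset.sum_eq_zero_iff.1 l.total) x (Finsupp.mem_support_iff.2 hx)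
    obtain ⟨j, hj⟩ := Multiset.exists_mem_of_ne_zero hx
    exact (l.pos x j hj).ne' (Multiset.sum_eq_zero_iff.1 h1 j hj)
  rw [partitionFunction, tsum_eq_single (⟨0, by simp, by simp⟩ : SpatialPartition d 0)]
  · simp [weight]
  · intro l hl'
    exact absurd (SpatialPartition.ext (hl l)) hl'

theorem integral_originOccupation (hδ : 0 < δ) {L : ℝ}
    (hs : Summable (offWeight (trap d δ) θ L)) {n : ℕ}
    [IsProbabilityMeasure (canonicalMeasure (trap d δ) θ L n)] {f : ℕ → ℂ} (hf : ∀ k, ‖f k‖ ≤ 1) :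
    ∫ l, f (originOccupation l) ∂(canonicalMeasure (trap d δ) θ L n) =
      (∑ k ∈ Finset.range (n + 1), (originMass d δ θ L n k : ℂ) * f k) /
        ((∑ k ∈ Finset.range (n + 1), originMass d δ θ L n k : ℝ) : ℂ) := by
  have hH : Measurable (originOccupation : SpatialPartition d n → ℕ) := fun _ _ => trivial
  have hν : IsProbabilityMeasure ((canonicalMeasure (trap d δ) θ L n).map originOccupation) :=
    Measure.isProbabilityMeasure_map hH.aemeasurable
  have hZ0 : 0 ≤ ∑ k ∈ Finset.range (n + 1), originMass d δ θ L n k :=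
    Finset.sum_nonneg fun k _ => originMass_nonneg L n k
  have hsing : ∀ k, ((canonicalMeasure (trap d δ) θ L n).map originOccupation).real {k} =
      if k ∈ Finset.range (n + 1) then
        (∑ k ∈ Finset.range (n + 1), originMass d δ θ L n k)⁻¹ * originMass d δ θ L n k else 0 := by
    intro k
    have h1 := tsum_weight_mul hδ hs n (Set.indicator {k} 1)
    rw [Measure.real, Measure.map_apply hH (measurableSet_singleton k), canonicalMeasure_apply]
    have h2 : ∀ l : SpatialPartition d n, (originOccupation ⁻¹' {k}).indicator
        (1 : SpatialPartition d n → ℝ≥0∞) l = Set.indicator {k} 1 (originOccupation l) :=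
      fun l => rfl
    simp_rw [h2]
    rw [h1, partitionFunction_eq hδ hs, ENNReal.toReal_mul, ENNReal.toReal_inv,
      ENNReal.toReal_ofReal hZ0]
    have h3 : ∀ j, ENNReal.ofReal (h θ j * occCoeff (offWeight (trap d δ) θ L) offSize (n - j)) *
        Set.indicator {k} 1 j = if k = j then ENNReal.ofReal (originMass d δ θ L n j) else 0 := by
      intro j
      by_cases hj : k = j
      · subst hj; simp [originMass]
      · simp [hj, Ne.symm hj]
    simp_rw [h3]
    rw [Finset.sum_ite_eq]
    split_ifs
    · rw [ENNReal.toReal_ofReal (originMass_nonneg L n k)]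
    · simp
  rw [← integral_map hH.aemeasurable (f := f) (measurable_of_countable f).aestronglyMeasurable,
    integral_countable (Integrable.of_bound (measurable_of_countable f).aestronglyMeasurable 1
      (ae_of_all _ hf)), tsum_eq_sum (s := Finset.range (n + 1)), Finset.sum_div]
  · refine Finset.sum_congr rfl fun k hk => ?_
    rw [hsing, if_pos hk, Complex.real_smul]
    push_cast
    ring
  · intro k hk
    rw [hsing, if_neg hk, zero_smul]

/-- Substitute k = n - m. As h vanishes at negative integers, the sum extends to all m, and the
truncated `n - m` in `f` does not matter there. -/
theorem sum_originMass_mul (L : ℝ) (n : ℕ) (f : ℕ → ℂ) :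
    ∑ k ∈ Finset.range (n + 1), (originMass d δ θ L n k : ℂ) * f k =
      (Real.exp (∑' i, offWeight (d := d) (trap d δ) θ L i) : ℂ) *
        ∑' m : ℕ, ((compoundProb (offWeight (trap d δ) θ L) offSize m *
          hInt θ ((n : ℤ) - m) : ℝ) : ℂ) * f (n - m) := by
  rw [tsum_eq_sum (s := Finset.range (n + 1)), Finset.mul_sum, ← Finset.sum_range_reflect]
  · refine Finset.sum_congr rfl fun m hm => ?_
    have hm' : m ≤ n := by simpa [Nat.lt_succ_iff] using hm
    have h1 : n + 1 - 1 - m = n - m := by omega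
    have h2 : (n : ℤ) - m = ((n - m : ℕ) : ℤ) := by omega
    have h3 : n - (n - m) = m := by omega
    rw [h1, h2, hInt_natCast, originMass, compoundProb, h3]
    have h4 : Real.exp (∑' i, offWeight (d := d) (trap d δ) θ L i) *
        Real.exp (-∑' i, offWeight (d := d) (trap d δ) θ L i) = 1 := by
      rw [← Real.exp_add, add_neg_cancel, Real.exp_zero]
    have h5 := congrArg (Complex.ofReal) h4
    push_cast at h5 ⊢
    linear_combination (-(h θ (n - m) : ℂ) *
      occCoeff (offWeight (trap d δ) θ L) offSize m * f (n - m)) * h5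
  · intro m hm
    have hm' : ¬ m ≤ n := by simpa [Nat.lt_succ_iff] using hm
    rw [hInt, if_neg (by omega)]
    simp

/-- The constant `a` cancels in the quotient. It is later taken to be h at its typical argument, so
that the tilting density is close to 1. -/
theorem integral_originOccupation_eq_tilted (hδ : 0 < δ) {L : ℝ}
    (hs : Summable (offWeight (trap d δ) θ L)) {n : ℕ}
    [IsProbabilityMeasure (canonicalMeasure (trap d δ) θ L n)] {f : ℕ → ℂ} (hf : ∀ k, ‖f k‖ ≤ 1)
    {a : ℝ} (ha : a ≠ 0) :
    ∫ l, f (originOccupation l) ∂(canonicalMeasure (trap d δ) θ L n) =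
      (∑' m : ℕ, ((compoundProb (offWeight (trap d δ) θ L) offSize m *
          (hInt θ ((n : ℤ) - m) / a) : ℝ) : ℂ) * f (n - m)) /
        ((∑' m : ℕ, compoundProb (offWeight (trap d δ) θ L) offSize m *
          (hInt θ ((n : ℤ) - m) / a) : ℝ) : ℂ) := by
  have h1 := sum_originMass_mul (d := d) (δ := δ) (θ := θ) L n f
  have h2 := sum_originMass_mul (d := d) (δ := δ) (θ := θ) L n fun _ => 1
  simp_rw [mul_one] at h2
  rw [integral_originOccupation hδ hs hf, Complex.ofReal_sum, h1, h2,
    mul_div_mul_left _ _ (by exact_mod_cast (Real.exp_pos _).ne')]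
  have ha' : (a : ℂ)⁻¹ ≠ 0 := by simpa using ha
  rw [← mul_div_mul_right _ _ ha', ← tsum_mul_right, ← tsum_mul_right, Complex.ofReal_tsum]
  congr 1
  · refine tsum_congr fun m => ?_
    push_cast
    ring
  · refine tsum_congr fun m => ?_
    push_cast
    ring

end

end SpatialPartitions

/-! ### Concentration of M against the variation of h. -/

namespace SpatialPartitions

theorem tendsto_of_eq_mul_pow {d : ℕ} {ρ : ℝ} (hρ : 0 < ρ) {L : ℕ → ℝ}
    (hL : ∀ n, 0 ≤ L n ∧ (n : ℝ) = ρ * L n ^ d) : Tendsto L atTop atTop := by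
  rw [tendsto_atTop]
  intro M
  filter_upwards [tendsto_natCast_atTop_atTop.eventually_gt_atTop (ρ * |M| ^ d)] with n hn
  rw [(hL n).2] at hn
  have h1 := lt_of_pow_lt_pow_left₀ d (hL n).1 (lt_of_mul_lt_mul_left hn hρ.le)
  exact (le_abs_self M).trans h1.le

section

variable {d : ℕ} {δ : ℝ} {θ : ℕ → ℝ≥0}

theorem momentConst_nonneg (d : ℕ) (δ : ℝ) (θ : ℕ → ℝ≥0) : 0 ≤ momentConst d δ θ :=
  mul_nonneg (mul_nonneg (cellConst_nonneg d δ) (by positivity))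
    (tsum_nonneg fun j => by positivity)

theorem offMean_nonneg (L : ℝ) : 0 ≤ offMean d δ θ L :=
  tsum_nonneg fun i => mul_nonneg (offWeight_nonneg _ _ _ i) (Nat.cast_nonneg _)

/-- Deviations of the number of particles away from the origin from its mean. -/
theorem tsum_tail_offOrigin_le (hδ : 0 < δ) (hδd : δ < d) (hT : CritSummable d δ θ) {L : ℝ}
    (hL : 1 ≤ L) {κ u : ℝ} (hκ : 1 / 2 ≤ κ) (hκ' : δ / d ≤ κ) :
    Summable (fun m : ℕ => if |(m : ℝ) - offMean d δ θ L| ≤ u then 0 else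
      compoundProb (offWeight (trap d δ) θ L) offSize m) ∧
    ∑' m : ℕ, (if |(m : ℝ) - offMean d δ θ L| ≤ u then 0 else
      compoundProb (offWeight (trap d δ) θ L) offSize m) ≤
      Real.exp (-((L ^ d) ^ (-κ) / 2 * u)) * (2 * Real.exp (momentConst d δ θ)) := by
  have hL0 : 0 < L := by linarith
  have hd : (0 : ℝ) < d := hδ.trans hδd
  have hA : 1 ≤ L ^ d := one_le_pow₀ hL
  have hA0 : 0 < L ^ d := by linarith
  -- `κ ≥ δ / d` keeps `t` within the energy gap, and `κ ≥ 1 / 2` keeps `t ^ 2 * L ^ d` bounded, so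
  -- the exponential moments at `±t` are bounded uniformly in `L`.
  set t := (L ^ d) ^ (-κ) / 2 with ht
  have ht0 : 0 ≤ t := by positivity
  have ht1 : t ≤ L ^ (-δ) / 2 := by
    have h1 : L ^ (-δ) = (L ^ d) ^ (-(δ / d)) := by
      rw [← Real.rpow_natCast, ← Real.rpow_mul hL0.le]
      congr 1
      field_simp
    rw [ht, h1]
    gcongr
  have ht2 : t ^ 2 * (L ^ d * momentConst d δ θ) ≤ momentConst d δ θ := by
    rw [← mul_assoc]
    refine mul_le_of_le_one_left (momentConst_nonneg d δ θ) ?_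
    have h1 : (L ^ d) ^ (-κ) ≤ (L ^ d) ^ (-(1 / 2 : ℝ)) :=
      Real.rpow_le_rpow_of_exponent_le hA (by linarith)
    have h2 : ((L ^ d) ^ (-(1 / 2 : ℝ))) ^ 2 * L ^ d = 1 := by
      rw [Real.rpow_neg hA0.le, ← Real.sqrt_eq_rpow, inv_pow, Real.sq_sqrt hA0.le,
        inv_mul_cancel₀ hA0.ne']
    calc t ^ 2 * L ^ d = ((L ^ d) ^ (-κ)) ^ 2 * L ^ d / 4 := by rw [ht]; ring
      _ ≤ ((L ^ d) ^ (-(1 / 2 : ℝ))) ^ 2 * L ^ d / 4 := by gcongr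
      _ ≤ 1 := by rw [h2]; norm_num
  have habs : |t| ≤ L ^ (-δ) / 2 := by rwa [abs_of_nonneg ht0]
  have hw := summable_offWeight hδ hδd hT hL0
  have hws := (hasSum_offWeight_mul_offSize hδ hδd hT hL0).summable
  have hA1 := hasSum_compoundProb_exp (offWeight_nonneg (trap d δ) θ L) hw hws t
    (summable_offWeight_mul_exp hδ hδd hT hL0 ht1)
  have hB1 := hasSum_compoundProb_exp (offWeight_nonneg (trap d δ) θ L) hw hws (-t)
    (summable_offWeight_mul_exp hδ hδd hT hL0 (by linarith))
  obtain ⟨h1, h2⟩ := tsum_tail_le (compoundProb_nonneg (offWeight_nonneg (trap d δ) θ L) offSize)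
    (u := u) ht0 hA1 hB1
  refine ⟨h1, h2.trans ?_⟩
  have e1 := (tsum_offWeight_mul_exp_sub_le hδ hδd hT hL0 habs).trans ht2
  have e2 := (tsum_offWeight_mul_exp_sub_le (t := -t) hδ hδd hT hL0 (by rwa [abs_neg])).trans
    ((neg_sq t).symm ▸ ht2)
  gcongr
  rw [two_mul]
  gcongr

/-- The weight of the origin is asymptotically constant under the law of the number of particles
away from the origin. -/
theorem tendsto_tsum_abs_hInt_div_sub_one (hδ : 0 < δ) (hδd : δ < d) (hT : CritSummable d δ θ)
    {ρ ρc : ℝ} (hρ : 0 < ρ) (hρc : ρc < ρ)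
    {C c a b : ℝ} (hC : 0 < C) (hc : 0 < c) (ha0 : 0 ≤ a) (hb : a + max (1 / 2) (δ / d) < b)
    (hb1 : b ≤ 1)
    (hlow : ∀ n : ℕ, 1 ≤ n → C⁻¹ * Real.exp (-(c * (n : ℝ) ^ a)) ≤ h θ n)
    (hupp : ∀ n : ℕ, 1 ≤ n → h θ n ≤ C * Real.exp (c * (n : ℝ) ^ a))
    (hflat : Tendsto (maxRatio θ b) atTop (𝓝 1))
    {L : ℕ → ℝ} (hL : ∀ n, 0 ≤ L n ∧ (n : ℝ) = ρ * L n ^ d)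
    (hmean : Tendsto (fun L => offMean d δ θ L / L ^ d) atTop (𝓝 ρc)) :
    (∀ᶠ n : ℕ in atTop, Summable fun m : ℕ =>
      compoundProb (offWeight (trap d δ) θ (L n)) offSize m *
        |hInt θ ((n : ℤ) - m) / h θ (n - ⌊offMean d δ θ (L n)⌋₊) - 1|) ∧
    Tendsto (fun n : ℕ => ∑' m : ℕ, compoundProb (offWeight (trap d δ) θ (L n)) offSize m *
        |hInt θ ((n : ℤ) - m) / h θ (n - ⌊offMean d δ θ (L n)⌋₊) - 1|) atTop (𝓝 0) := by
  have hpos : ∀ n : ℕ, 1 ≤ n → 0 < h θ n := fun n hn =>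
    lt_of_lt_of_le (by positivity) (hlow n hn)
  have hLtop := tendsto_of_eq_mul_pow hρ hL
  set κ := max (1 / 2) (δ / d) with hκ
  have hκ1 : 1 / 2 ≤ κ := le_max_left _ _
  have hκ2 : δ / d ≤ κ := le_max_right _ _
  set μ : ℕ → ℝ := fun n => offMean d δ θ (L n) with hμ
  set N : ℕ → ℕ := fun n => n - ⌊μ n⌋₊ with hN
  set p : ℕ → ℕ → ℝ := fun n => compoundProb (offWeight (trap d δ) θ (L n)) offSize with hp
  have hp0 : ∀ n m, 0 ≤ p n m := fun n m => compoundProb_nonneg (offWeight_nonneg _ _ _) _ _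
  have hμ0 : ∀ n, 0 ≤ μ n := fun n => offMean_nonneg (L n)
  -- A positive fraction of the particles is left for the origin: eventually `μ n / L ^ d` is below
  -- the midpoint of `ρc` and `ρ`.
  obtain ⟨η, hη0, hη⟩ : ∃ η > 0, ∀ᶠ n : ℕ in atTop, μ n ≤ (1 - η) * n := by
    refine ⟨(ρ - ρc) / (2 * ρ), div_pos (by linarith) (by linarith), ?_⟩
    filter_upwards [(hmean.comp hLtop).eventually_lt_const (show ρc < (ρ + ρc) / 2 by linarith),
      hLtop.eventually_gt_atTop 0] with n h1 h2
    simp only [Function.comp] at h1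
    rw [div_lt_iff₀ (by positivity)] at h1
    rw [(hL n).2]
    refine h1.le.trans (le_of_eq ?_)
    field_simp
    ring
  have hη1 : ∀ᶠ n : ℕ in atTop, ⌊μ n⌋₊ ≤ n ∧ η * n ≤ N n := by
    filter_upwards [hη] with n hn
    have h1 : ⌊μ n⌋₊ ≤ n := by
      refine Nat.floor_le_of_le (hn.trans ?_)
      have : 0 ≤ η * n := by positivity
      linarith
    refine ⟨h1, ?_⟩
    have := Nat.floor_le (hμ0 n)
    simp only [hN]
    rw [Nat.cast_sub h1]
    linarith
  have hNtop : Tendsto N atTop atTop := by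
    refine tendsto_natCast_atTop_iff (R := ℝ) |>.1 (tendsto_atTop_mono' _
      (hη1.mono fun n hn => hn.2) (tendsto_natCast_atTop_atTop.const_mul_atTop hη0))
  have hb0 : 0 < b := by linarith
  have hNb : Tendsto (fun n => (N n : ℝ) ^ b) atTop atTop :=
    (tendsto_rpow_atTop hb0).comp (tendsto_natCast_atTop_atTop.comp hNtop)
  -- The upper bound on h starts at 1, so `h θ 0` enters separately; the final 1 accounts for the `-
  -- 1` inside the absolute value.
  set G : ℝ := max C (h θ 0) * C + 1 with hG
  have hhupp : ∀ n m : ℕ, hInt θ ((n : ℤ) - m) ≤ max C (h θ 0) * Real.exp (c * (n : ℝ) ^ a) := by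
    intro n m
    have hmx : 0 ≤ max C (h θ 0) := hC.le.trans (le_max_left _ _)
    rcases lt_trichotomy ((n : ℤ) - m) 0 with hlt | heq | hgt
    · rw [hInt, if_neg (by omega)]
      positivity
    · rw [heq]
      calc hInt θ 0 = h θ 0 * 1 := by simp [hInt]
        _ ≤ _ := by
          gcongr
          · exact le_max_right _ _
          · exact Real.one_le_exp (by positivity)
    · obtain ⟨k, hk⟩ : ∃ k : ℕ, (n : ℤ) - m = k := ⟨((n : ℤ) - m).toNat, by omega⟩
      rw [hk, hInt_natCast]
      refine (hupp k (by omega)).trans ?_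
      gcongr
      · exact le_max_left _ _
      · omega
  have hGbd : ∀ n : ℕ, 1 ≤ N n → ∀ m : ℕ,
      |hInt θ ((n : ℤ) - m) / h θ (N n) - 1| ≤ G * Real.exp (2 * c * (n : ℝ) ^ a) := by
    intro n hn m
    have h1 := hlow (N n) hn
    have h2 : C⁻¹ * Real.exp (-(c * (n : ℝ) ^ a)) ≤ h θ (N n) := by
      refine le_trans ?_ h1
      gcongr
      exact Nat.sub_le _ _
    have h3 : hInt θ ((n : ℤ) - m) / h θ (N n) ≤
        max C (h θ 0) * C * Real.exp (2 * c * (n : ℝ) ^ a) := by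
      rw [div_le_iff₀ (hpos _ hn)]
      calc _ ≤ max C (h θ 0) * Real.exp (c * (n : ℝ) ^ a) := hhupp n m
        _ = max C (h θ 0) * C * Real.exp (2 * c * (n : ℝ) ^ a) *
            (C⁻¹ * Real.exp (-(c * (n : ℝ) ^ a))) := by
          have : Real.exp (c * (n : ℝ) ^ a) =
              Real.exp (2 * c * (n : ℝ) ^ a) * Real.exp (-(c * (n : ℝ) ^ a)) := by
            rw [← Real.exp_add]; ring_nf
          rw [this]
          field_simp
        _ ≤ _ := by
          have hmx : 0 ≤ max C (h θ 0) := hC.le.trans (le_max_left _ _)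
          gcongr
    have h4 : 0 ≤ hInt θ ((n : ℤ) - m) / h θ (N n) := div_nonneg (hInt_nonneg _ _) (h_nonneg _ _)
    have h5 : 1 ≤ Real.exp (2 * c * (n : ℝ) ^ a) := Real.one_le_exp (by positivity)
    have h6 : max C (h θ 0) * C * Real.exp (2 * c * (n : ℝ) ^ a) + 1 ≤
        G * Real.exp (2 * c * (n : ℝ) ^ a) := by rw [hG]; linarith
    rw [abs_le]
    constructor <;> linarith
  have hpsum : ∀ᶠ n in atTop, HasSum (p n) 1 := by
    filter_upwards [hLtop.eventually_gt_atTop 0] with n hn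
    exact hasSum_compoundProb (offWeight_nonneg _ _ _) (summable_offWeight hδ hδd hT hn)
      (hasSum_offWeight_mul_offSize hδ hδd hT hn).summable
  have hsumm : ∀ᶠ n : ℕ in atTop, Summable fun m : ℕ => p n m *
      |hInt θ ((n : ℤ) - m) / h θ (N n) - 1| := by
    filter_upwards [hpsum, hNtop.eventually_ge_atTop 1] with n h1 h2
    refine Summable.of_nonneg_of_le (fun m => mul_nonneg (hp0 n m) (abs_nonneg _)) (fun m => ?_)
      (h1.summable.mul_right (G * Real.exp (2 * c * (n : ℝ) ^ a)))
    exact mul_le_mul_of_nonneg_left (hGbd n h2 m) (hp0 n m)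
  refine ⟨hsumm, ?_⟩
  -- The Chernoff exponent is `(L ^ d) ^ (-κ) / 2` times `N ^ b / 4`; insert `L ^ d = n / ρ` and `N
  -- ≥ η n`.
  set A : ℝ := ρ ^ κ * η ^ b / 8 with hA
  have hA0 : 0 < A := by positivity
  have hG0 : 0 ≤ G := by
    have hmx : 0 ≤ max C (h θ 0) := hC.le.trans (le_max_left _ _)
    positivity
  set E : ℕ → ℝ := fun n => G * (2 * Real.exp (momentConst d δ θ)) *
    Real.exp (-(A * (n : ℝ) ^ (b - κ) - 2 * c * (n : ℝ) ^ a)) with hE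
  have hEtend : Tendsto E atTop (𝓝 0) := by
    have h1 := tendsto_mul_sub_mul_rpow (A := A) (B := 2 * c) (p := a) (q := b - κ) hA0 ha0
      (by linarith)
    have h2 := (Real.tendsto_exp_neg_atTop_nhds_zero.comp h1).const_mul
      (G * (2 * Real.exp (momentConst d δ θ)))
    rw [mul_zero] at h2
    exact h2
  have hmain : ∀ ε > 0, ∀ᶠ n : ℕ in atTop, ∑' m : ℕ, p n m *
      |hInt θ ((n : ℤ) - m) / h θ (N n) - 1| ≤ ε + E n := by
    intro ε hε
    filter_upwards [hpsum, hsumm, hη1, hNtop.eventually_ge_atTop 1, hNb.eventually_ge_atTop 4,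
      hNtop.eventually (eventually_abs_hInt_div_sub_one_le hpos hb0.le hb1 hflat hε),
      hLtop.eventually_ge_atTop 1] with n h1 h2 h3 h4 h5 h6 h7
    -- A quarter of the window: rounding the mean down costs at most 1, which is at most `N ^ b /
    -- 4`, so the shift stays within the `N ^ b / 2` where h is flat.
    set u : ℝ := (N n : ℝ) ^ b / 4 with hu
    obtain ⟨ht1, ht2⟩ := tsum_tail_offOrigin_le (u := u) hδ hδd hT h7 hκ1 hκ2
    have hle : ∀ m : ℕ, p n m * |hInt θ ((n : ℤ) - m) / h θ (N n) - 1| ≤ p n m * ε +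
        (if |(m : ℝ) - μ n| ≤ u then 0 else p n m) * (G * Real.exp (2 * c * (n : ℝ) ^ a)) := by
      intro m
      split_ifs with hm
      · rw [zero_mul, add_zero]
        refine mul_le_mul_of_nonneg_left ?_ (hp0 n m)
        have h8 : (n : ℤ) - m = (N n : ℤ) + ((⌊μ n⌋₊ : ℤ) - m) := by
          simp only [hN]; omega
        rw [h8]
        refine h6 _ ?_
        have h9 := Nat.floor_le (hμ0 n)
        have h10 := Nat.lt_floor_add_one (μ n)
        rw [abs_le] at hm
        push_cast
        rw [abs_le]
        constructor <;> linarith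
      · have h8 := mul_le_mul_of_nonneg_left (hGbd n h4 m) (hp0 n m)
        have h9 := mul_nonneg (hp0 n m) hε.le
        linarith
    have hs1 := h1.mul_right ε
    have hs2 := ht1.hasSum.mul_right (G * Real.exp (2 * c * (n : ℝ) ^ a))
    have h8 := hasSum_le hle h2.hasSum (hs1.add hs2)
    refine h8.trans ?_
    rw [one_mul]
    gcongr
    have hn0 : (0 : ℝ) < n := by
      have h9 : N n ≤ n := Nat.sub_le _ _
      exact_mod_cast (by omega : 0 < n)
    have hLd : L n ^ d = n / ρ := by rw [(hL n).2]; field_simp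
    have htu : A * (n : ℝ) ^ (b - κ) ≤ (L n ^ d) ^ (-κ) / 2 * u := by
      have h9 : (η * n) ^ b ≤ (N n : ℝ) ^ b := Real.rpow_le_rpow (by positivity) h3.2 hb0.le
      rw [Real.mul_rpow hη0.le hn0.le] at h9
      have h10 : (L n ^ d) ^ (-κ) = ρ ^ κ * (n : ℝ) ^ (-κ) := by
        rw [hLd, Real.div_rpow hn0.le hρ.le, Real.rpow_neg hρ.le, div_inv_eq_mul, mul_comm]
      rw [h10, hA, hu, sub_eq_add_neg, Real.rpow_add hn0]
      calc ρ ^ κ * η ^ b / 8 * ((n : ℝ) ^ b * (n : ℝ) ^ (-κ))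
          = ρ ^ κ * (n : ℝ) ^ (-κ) / 2 * (η ^ b * (n : ℝ) ^ b / 4) := by ring
        _ ≤ _ := by gcongr
    calc _ ≤ Real.exp (-((L n ^ d) ^ (-κ) / 2 * u)) * (2 * Real.exp (momentConst d δ θ)) *
          (G * Real.exp (2 * c * (n : ℝ) ^ a)) := by gcongr
      _ ≤ Real.exp (-(A * (n : ℝ) ^ (b - κ))) * (2 * Real.exp (momentConst d δ θ)) *
          (G * Real.exp (2 * c * (n : ℝ) ^ a)) := by gcongr
      _ = E n := by
          simp only [hE]
          have : Real.exp (-(A * (n : ℝ) ^ (b - κ) - 2 * c * (n : ℝ) ^ a)) =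
              Real.exp (-(A * (n : ℝ) ^ (b - κ))) * Real.exp (2 * c * (n : ℝ) ^ a) := by
            rw [← Real.exp_add]; ring_nf
          rw [this]
          ring
  rw [Metric.tendsto_atTop']
  intro ε hε
  have h1 := (hmain (ε / 2) (by positivity)).and
    (hEtend.eventually_lt_const (show (0 : ℝ) < ε / 2 by positivity))
  obtain ⟨n₀, hn₀⟩ := eventually_atTop.1 h1
  refine ⟨n₀, fun n hn => ?_⟩
  have h2 := hn₀ n hn.le
  rw [Real.dist_0_eq_abs, abs_of_nonneg
    (tsum_nonneg fun m => mul_nonneg (hp0 n m) (abs_nonneg _))]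
  linarith [h2.1, h2.2]

theorem tendsto_tsum_compoundProb_cexp (hδ : 0 < δ) (hδd : δ < d) (hT : CritSummable d δ θ)
    (x : ℝ) :
    Tendsto (fun L : ℝ => ∑' m : ℕ, (compoundProb (offWeight (trap d δ) θ L) offSize m : ℂ) *
      Complex.exp ((x / √(L ^ d) : ℝ) * Complex.I * (m - (offMean d δ θ L : ℝ)))) atTop
      (𝓝 (Complex.exp (-(x ^ 2 / 2 * (trapIntegral d δ *
        ∑' j : ℕ+, ((j : ℕ) : ℝ) ^ (-((d : ℝ) / δ)) * (((j : ℕ) : ℝ) * θ j)) : ℝ)))) := by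
  refine ((Complex.continuous_exp.tendsto _).comp
    (tendsto_tsum_offWeight_cexp (θ := θ) hδ hδd hT x)).congr' ?_
  filter_upwards [eventually_gt_atTop 0] with L hL
  refine (HasSum.tsum_eq ?_).symm
  refine hasSum_compoundProb_cexp (summable_offWeight hδ hδd hT hL)
    (hasSum_offWeight_mul_offSize hδ hδd hT hL).summable _ ?_
  refine (summable_offWeight hδ hδd hT hL).congr fun i => ?_
  rw [norm_mul, Complex.norm_of_nonneg (offWeight_nonneg _ _ _ i)]
  have : ((x / √(L ^ d) : ℝ) : ℂ) * Complex.I * (offSize i : ℂ) =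
      ((x / √(L ^ d) * offSize i : ℝ) : ℂ) * Complex.I := by push_cast; ring
  rw [this, Complex.norm_exp_ofReal_mul_I, mul_one]

end

end SpatialPartitions

/-! ### Assembly of the central limit theorem. -/

open SpatialPartitions in
theorem theorem5p2 (d : ℕ) (δ : ℝ) (hδ : 0 < δ) (hδd : δ < d)
    (θ : ℕ → ℝ≥0)
    (hθ : Summable fun j : ℕ => (j : ℝ) * (θ j : ℝ) / (j : ℝ) ^ ((d : ℝ) / δ))
    (ρ : ℝ) (hρ : critDensity (trap d δ) θ < ENNReal.ofReal ρ)
    (C c a b : ℝ) (hC : 0 < C) (hc : 0 < c)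
    (ha0 : 0 ≤ a) (ha : a < min (1 / 2) (1 - δ / d)) (hb : a + max (1 / 2) (δ / d) < b)
    (hlow : ∀ n : ℕ, 1 ≤ n → C⁻¹ * Real.exp (-(c * (n : ℝ) ^ a)) ≤ h θ n)
    (hupp : ∀ n : ℕ, 1 ≤ n → h θ n ≤ C * Real.exp (c * (n : ℝ) ^ a))
    (hflat : Tendsto (maxRatio θ b) atTop (𝓝 1))
    (L : ℕ → ℝ) (hL : ∀ n, 0 ≤ L n ∧ (n : ℝ) = ρ * L n ^ d) :
    critVariance (trap d δ) θ ≠ 0 ∧ critVariance (trap d δ) θ ≠ ∞ ∧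
    ∃ _ : ∀ n, IsProbabilityMeasure (canonicalMeasure (trap d δ) θ (L n) n),
      TendstoInDistribution
        (fun (n : ℕ) (l : SpatialPartition d n) =>
          ((originOccupation l : ℝ) - L n ^ d * (ρ - critDensityAt (trap d δ) θ (L n))) /
            (critStdDev (trap d δ) θ * L n ^ ((d : ℝ) / 2)))
        atTop (id : ℝ → ℝ)
        (fun n => canonicalMeasure (trap d δ) θ (L n) n) (gaussianReal 0 1) := by
  have hT : CritSummable d δ θ := critSummable_of_summable hθ
  have hd : (0 : ℝ) < d := hδ.trans hδd
  have ha1 : a < 1 := (ha.trans_le (min_le_left _ _)).trans (by norm_num)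
  have hpos : ∀ n : ℕ, 1 ≤ n → 0 < h θ n := fun n hn =>
    lt_of_lt_of_le (by positivity) (hlow n hn)
  have hcrit := critFugacity_eq_one hδ hδd hT hC ha0 ha1 hlow
  have hρ0 : 0 < ρ := by
    have : (0 : ℝ≥0∞) < ENNReal.ofReal ρ := bot_le.trans_lt hρ
    simpa using this
  have hK : 0 < trapIntegral d δ := integral_exp_trap_pos hδ hδd
  set T : ℝ := ∑' j : ℕ+, ((j : ℕ) : ℝ) ^ (-((d : ℝ) / δ)) * (((j : ℕ) : ℝ) * θ j) with hTdef
  -- `h θ 1 = θ 1`, and the lower bound at 1 makes it positive; this is what makes the variance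
  -- nonzero.
  have hθ1 : 0 < (θ 1 : ℝ) := by
    by_contra h0
    have h1 : θ 1 = 0 := le_antisymm (by exact_mod_cast not_lt.1 h0) bot_le
    have h2 := hpos 1 le_rfl
    simp [h, gibbsWeight, h1] at h2
  have hTpos : 0 < T := hT.tsum_pos (fun j => by positivity) 1 (by simpa using hθ1)
  have hσ2 : 0 < trapIntegral d δ * T := mul_pos hK hTpos
  have hvar := critVariance_eq hδ hδd hT
  rw [← hTdef] at hvar
  have hstd : critStdDev (trap d δ) θ = √(trapIntegral d δ * T) := by
    rw [critStdDev, hvar, ENNReal.toReal_ofReal hσ2.le]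
  have hσ : 0 < √(trapIntegral d δ * T) := Real.sqrt_pos.2 hσ2
  have hLpos : ∀ n, 1 ≤ n → 0 < L n := by
    intro n hn
    refine lt_of_le_of_ne (hL n).1 fun h0 => ?_
    have h1 := (hL n).2
    have hd' : d ≠ 0 := by rintro rfl; simp at hd
    rw [← h0, zero_pow hd', mul_zero] at h1
    have : (1 : ℝ) ≤ n := by exact_mod_cast hn
    linarith
  have hprob : ∀ n, IsProbabilityMeasure (canonicalMeasure (trap d δ) θ (L n) n) := by
    intro n
    rcases Nat.eq_zero_or_pos n with rfl | hn
    · refine isProbabilityMeasure_canonicalMeasure ?_ ?_ <;> simp [partitionFunction_zero]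
    · have hs := summable_offWeight hδ hδd hT (hLpos n hn)
      refine isProbabilityMeasure_canonicalMeasure ?_ ?_ <;> rw [partitionFunction_eq hδ hs]
      · exact (ENNReal.ofReal_pos.2 (sum_originMass_pos hs (hpos n hn))).ne'
      · exact ENNReal.ofReal_ne_top
  refine ⟨?_, ?_, hprob, ?_⟩
  · rw [hvar]
    exact (ENNReal.ofReal_pos.2 hσ2).ne'
  · rw [hvar]
    exact ENNReal.ofReal_ne_top
  have hLtop := tendsto_of_eq_mul_pow hρ0 hL
  -- The upper bound on `a` says precisely that `a + max (1/2) (δ/d) < 1`, so `b` may be lowered to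
  -- `min b 1`.
  obtain ⟨b', hb'1, hb'2, hb'3⟩ : ∃ b', a + max (1 / 2) (δ / d) < b' ∧ b' ≤ 1 ∧ b' ≤ b := by
    refine ⟨min b 1, lt_min hb ?_, min_le_right _ _, min_le_left _ _⟩
    rcases lt_min_iff.1 ha with ⟨h1, h2⟩
    rcases max_cases (1 / 2 : ℝ) (δ / d) with ⟨h3, -⟩ | ⟨h3, -⟩ <;> rw [h3] <;> linarith
  have hflat' := tendsto_maxRatio_of_le hpos hb'3 hflat
  set ρc : ℝ := ∑' j : ℕ+, (trapIntegral d δ * ((j : ℕ) : ℝ) ^ (-((d : ℝ) / δ))) * θ j with hρcdef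
  have hρc : ρc < ρ := by
    rw [critDensity, hcrit, density_one hδ hδd hT, ENNReal.ofReal_lt_ofReal_iff hρ0] at hρ
    exact hρ
  obtain ⟨htilt1, htilt2⟩ := tendsto_tsum_abs_hInt_div_sub_one hδ hδd hT hρ0 hρc hC hc ha0 hb'1
    hb'2 hlow hupp hflat' hL (tendsto_offMean_div hδ hδd hT)
  have hmeas : ∀ n, Measurable fun l : SpatialPartition d n =>
      ((originOccupation l : ℝ) - L n ^ d * (ρ - critDensityAt (trap d δ) θ (L n))) /
        (critStdDev (trap d δ) θ * L n ^ ((d : ℝ) / 2)) := fun n _ _ => trivial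
  refine ⟨fun n => (hmeas n).aemeasurable, aemeasurable_id, ?_⟩
  refine ProbabilityMeasure.tendsto_iff_tendsto_charFun.2 fun ξ => ?_
  simp only [ProbabilityMeasure.coe_mk, Measure.map_id, charFun_gaussianReal]
  -- The minus sign is there because H_0 - (n - E M) = -(M - E M).
  set x : ℝ := -ξ / √(trapIntegral d δ * T) with hx
  have hlim := (tendsto_tsum_compoundProb_cexp (θ := θ) hδ hδd hT x).comp hLtop
  have hval : x ^ 2 / 2 * (trapIntegral d δ * T) = ξ ^ 2 / 2 := by
    rw [hx, div_pow, Real.sq_sqrt hσ2.le]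
    field_simp
  rw [← hTdef, hval] at hlim
  have hfinal := tendsto_tilted
    (p := fun n => compoundProb (offWeight (trap d δ) θ (L n)) offSize)
    (g := fun n m => hInt θ ((n : ℤ) - m) / h θ (n - ⌊offMean d δ θ (L n)⌋₊))
    (f := fun n m => Complex.exp ((x / √(L n ^ d) : ℝ) * Complex.I *
      (m - (offMean d δ θ (L n) : ℝ)))) (by
      filter_upwards [eventually_ge_atTop 1] with n hn
      exact ⟨compoundProb_nonneg (offWeight_nonneg _ _ _) _,
        hasSum_compoundProb (offWeight_nonneg _ _ _) (summable_offWeight hδ hδd hT (hLpos n hn))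
        (hasSum_offWeight_mul_offSize hδ hδd hT (hLpos n hn)).summable⟩) htilt1 htilt2
    (fun n m => by
      have : ((x / √(L n ^ d) : ℝ) : ℂ) * Complex.I * ((m : ℂ) - (offMean d δ θ (L n) : ℝ)) =
        ((x / √(L n ^ d) * (m - offMean d δ θ (L n)) : ℝ) : ℂ) * Complex.I := by push_cast; ring
      rw [this, Complex.norm_exp_ofReal_mul_I]) hlim
  have hgoal : Complex.exp (-((ξ ^ 2 / 2 : ℝ) : ℂ)) =
      Complex.exp (ξ * (0 : ℝ) * Complex.I - (1 : ℝ≥0) * ξ ^ 2 / 2) := by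
    congr 1
    push_cast
    ring
  rw [← hgoal]
  -- The argument of h in the normalization may be 0 for small `n`; `h θ 0 = 1`.
  have hpos0 : ∀ n, h θ n ≠ 0 := by
    intro n
    rcases Nat.eq_zero_or_pos n with rfl | hn
    · simp [h, gibbsWeight]
    · exact (hpos n hn).ne'
  refine hfinal.congr' ?_
  filter_upwards [eventually_ge_atTop 1] with n hn
  have hLn := hLpos n hn
  have hmean := pow_mul_critDensityAt hδ hδd hT hcrit hLn
  have hsqrt : L n ^ ((d : ℝ) / 2) = √(L n ^ d) := by
    rw [Real.sqrt_eq_rpow, ← Real.rpow_natCast, ← Real.rpow_mul hLn.le]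
    ring_nf
  have hsq0 : 0 < √(L n ^ d) := Real.sqrt_pos.2 (by positivity)
  have hint := integral_originOccupation_eq_tilted hδ (summable_offWeight hδ hδd hT hLn) (n := n)
    (f := fun k => Complex.exp (ξ * (((k : ℝ) - L n ^ d *
      (ρ - critDensityAt (trap d δ) θ (L n))) /
        (critStdDev (trap d δ) θ * L n ^ ((d : ℝ) / 2)) : ℝ) * Complex.I))
    (fun k => by rw [← Complex.ofReal_mul, Complex.norm_exp_ofReal_mul_I])
    (hpos0 (n - ⌊offMean d δ θ (L n)⌋₊))
  rw [charFun_apply_real, integral_map (hmeas n).aemeasurable (by fun_prop), hint]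
  congr 1
  refine tsum_congr fun m => ?_
  -- The two exponents agree only for `m ≤ n`; beyond that the weight vanishes.
  by_cases hm : m ≤ n
  · congr 2
    have h0 : L n ^ d * (ρ - critDensityAt (trap d δ) θ (L n)) = n - offMean d δ θ (L n) := by
      rw [mul_sub, hmean, (hL n).2]
      ring
    rw [hstd, hsqrt, h0, Nat.cast_sub hm, hx]
    push_cast
    have h1 : ((√(trapIntegral d δ * T) : ℝ) : ℂ) ≠ 0 := by exact_mod_cast hσ.ne'
    have h2 : ((√(L n ^ d) : ℝ) : ℂ) ≠ 0 := by exact_mod_cast hsq0.ne'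
    field_simp
    ring
  · have : hInt θ ((n : ℤ) - m) = 0 := by rw [hInt, if_neg (by omega)]
    simp [this]
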